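/- Notation. For $d\ge 1$ and $0\le j<d$ let $$E(d,j)=\langle \alpha,\beta,\gamma : \alpha^d=\beta^d=\gamma^j,\ \gamma^d=[\alpha,\gamma]=[\beta,\gamma]=1,\ [\alpha,\beta]=\gamma\rangle,$$ where $[g,h]=g^{-1}h^{-1}gh$. For $m,d\ge 1$ let $\mathcal A_{m,d}$ be the class of finite abelian groups whose minimal number of generators is $m$ and which contain an element of order $d$. For an isomorphism $\varphi:D_1\to D_2$ between central subgroups $D_i\le Z(G_i)$, the central product is $G_1\curlywedge_\varphi G_2=(G_1\times G_2)/\{(z,\varphi(z)^{-1}): z\in D_1\}$; $\varphi$ is maximal if no isomorphism between central subgroups of $G_1$ and $G_2$ properly extends it. For $n,m\ge 1$ let $\mathcal S_{n,m}$ be the class of finite groups isomorphic to $(\cdots((E_1\curlywedge_{\varphi_1} E_2)\curlywedge_{\varphi_2}\cdots)\curlywedge_{\varphi_{n-1}} E_n)\curlywedge_{\varphi_n}A$, where for some $d\ge 1$ each $E_k$ is $E(d,j_k)$ with $0\le j_k<d$, $A\in\mathcal A_{m,d}$, and each $\varphi_k$ is a maximal central isomorphism between cyclic subgroups of order $d$.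 For a prime $p$, a finite $p$-group $S$ is special if it is elementary abelian, or if $\Phi(S)=Z(S)=[S,S]$ and this subgroup is elementary abelian; it is extra-special if moreover it is non-abelian with cyclic centre. Lemma 2.9. Let $p$ be a prime, $r\ge 1$, and let $S$ be a special $p$-group of order $p^r$. (1) $S$ is isomorphic to a subgroup of a direct product $G_1\times\cdots\times G_r$ in which each $G_i$ belongs to $\mathcal S_{n,m}$ for some $n,m\ge1$ (depending on $i$) with $2n+m\le\max(r,3)$. (2) Suppose that $S$ is non-abelian and $|Z(S)|=p^s$. Then there are subgroups $K_1,\dots,K_s\le Z(S)$ with $K_1\cap\dots\cap K_s=1$ (so that $S$ embeds in $\prod_{i=1}^s S/K_i$) such that for each $i$ there are $n,m\ge 1$ with $2n+m\le r$ for which $S/K_i\in\mathcal S_{n,m}$; more precisely, $S/K_i$ is an iterated central product as above, with $d=p$, of groups $E_1,\dots,E_n\in\{E(p,0),E(p,1)\}$, each extra-special of order $p^3$, and a group $A\in\mathcal A_{m,p}$ with $A\cong \mathbb Z_p^m$ or $A\cong\mathbb Z_p^{m-1}\times\mathbb Z_{p^2}$. -/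

import Mathlib

namespace SpecialGroups

/-- Elementary abelian `p`-groups. -/
def IsElementaryAbelian (p : ℕ) (H : Type*) [Group H] : Prop :=
  (∀ x y : H, x * y = y * x) ∧ ∀ x : H, x ^ p = 1

/-- A finite `p`-group is special if it is elementary abelian, or if its Frattini subgroup, centre
and commutator subgroup coincide and are elementary abelian. -/
def IsSpecial (p : ℕ) (S : Type*) [Group S] : Prop :=
  Finite S ∧ IsPGroup p S ∧
    (IsElementaryAbelian p S ∨
      (frattini S = Subgroup.center S ∧ Subgroup.center S = commutator S ∧
        IsElementaryAbelian p (frattini S)))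

/-- A non-abelian special `p`-group with cyclic centre. -/
def IsExtraSpecial (p : ℕ) (S : Type*) [Group S] : Prop :=
  IsSpecial p S ∧ (¬ ∀ x y : S, x * y = y * x) ∧ IsCyclic (Subgroup.center S)

/-- The commutator in the convention `[g, h] = g⁻¹ h⁻¹ g h`. -/
def groupComm {G : Type*} [Group G] (g h : G) : G := g⁻¹ * h⁻¹ * g * h

/-- The three generators of the groups `E d j`. -/
inductive Gen : Type
  | α
  | β
  | γ

/-- The relators of
`⟨α, β, γ : α ^ d = β ^ d = γ ^ j, γ ^ d = [α, γ] = [β, γ] = 1, [α, β] = γ⟩`. -/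
def relators (d j : ℕ) : Set (FreeGroup Gen) :=
  let a := FreeGroup.of Gen.α
  let b := FreeGroup.of Gen.β
  let c := FreeGroup.of Gen.γ
  {a ^ d * (c ^ j)⁻¹, b ^ d * (c ^ j)⁻¹, c ^ d, groupComm a c, groupComm b c, groupComm a b * c⁻¹}

/-- The group `E(d, j)`. -/
abbrev E (d j : ℕ) : Type := PresentedGroup (relators d j)

/-- `A` belongs to `𝒜_{m,d}`: a finite abelian group whose minimal number of generators is `m` and
which has an element of order `d`. -/
def MemA (m d : ℕ) (A : Type*) [CommGroup A] : Prop :=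
  ∃ _ : Finite A, Group.rank A = m ∧ ∃ a : A, orderOf a = d

/-- An isomorphism between central subgroups of `G₁` and `G₂`. -/
structure CentralIso (G₁ G₂ : Type*) [Group G₁] [Group G₂] where
  source : Subgroup G₁
  target : Subgroup G₂
  source_le : source ≤ Subgroup.center G₁
  target_le : target ≤ Subgroup.center G₂
  equiv : source ≃* target

namespace CentralIso

variable {G₁ G₂ : Type*} [Group G₁] [Group G₂]

/-- `ψ` extends `φ`. -/
def Extends (ψ φ : CentralIso G₁ G₂) : Prop :=
  ∃ h : φ.source ≤ ψ.source,
    ∀ z : φ.source, (ψ.equiv (Subgroup.inclusion h z) : G₂) = φ.equiv z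

/-- The only isomorphism between central subgroups extending `φ` is `φ` itself. -/
def IsMaximal (φ : CentralIso G₁ G₂) : Prop :=
  ∀ ψ : CentralIso G₁ G₂, ψ.Extends φ → ψ = φ

/-- The subgroup `{(z, φ(z)⁻¹) : z ∈ D₁}` of `G₁ × G₂`. -/
def kernel (φ : CentralIso G₁ G₂) : Subgroup (G₁ × G₂) where
  carrier := {x | ∃ z : φ.source, x = ((z : G₁), ((φ.equiv z : G₂))⁻¹)}
  one_mem' := ⟨1, by simp [Prod.one_eq_mk]⟩
  mul_mem' := by
    rintro _ _ ⟨z, rfl⟩ ⟨w, rfl⟩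
    refine ⟨z * w, ?_⟩
    have h := Subgroup.mem_center_iff.1 (φ.target_le (φ.equiv z).2) ((φ.equiv w : G₂))
    simp only [Prod.mk_mul_mk, map_mul, Subgroup.coe_mul, Prod.mk.injEq, true_and]
    rw [← mul_inv_rev, h]
  inv_mem' := by
    rintro _ ⟨z, rfl⟩
    exact ⟨z⁻¹, by simp⟩

instance kernel_normal (φ : CentralIso G₁ G₂) : φ.kernel.Normal where
  conj_mem := by
    rintro _ ⟨z, rfl⟩ ⟨g, h⟩
    refine ⟨z, ?_⟩
    have h₁ := Subgroup.mem_center_iff.1 (φ.source_le z.2) g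
    have h₂ := Subgroup.mem_center_iff.1 (inv_mem (φ.target_le (φ.equiv z).2)) h
    simp only [Prod.mk_mul_mk, Prod.inv_mk, Prod.mk.injEq]
    rw [h₁, h₂]
    simp

/-- The external central product `G₁ ⋏_φ G₂`. -/
abbrev CentralProduct (φ : CentralIso G₁ G₂) := (G₁ × G₂) ⧸ φ.kernel

end CentralIso

/-- `H ≅ G₀ ⋏ G₁ ⋏ ⋯ ⋏ Gₖ` (bracketed to the left), where `l = [G₁, …, Gₖ]`, for some maximal
central isomorphisms, each of which identifies cyclic subgroups of order `d`. -/
def IsIteratedCentralProductFrom (d : ℕ) (H : Type*) [Group H] :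
    GrpCat.{0} → List GrpCat.{0} → Prop
  | G₀, [] => Nonempty (H ≃* G₀)
  | G₀, G₁ :: l => ∃ φ : CentralIso G₀ G₁, φ.IsMaximal ∧ IsCyclic φ.source ∧
      Nat.card φ.source = d ∧ IsIteratedCentralProductFrom d H (GrpCat.of φ.CentralProduct) l

/-- `H` is an iterated central product (in the above sense) of the groups in a list. The product of
the empty list, which is never used, is the trivial group. -/
def IsIteratedCentralProduct (d : ℕ) (H : Type*) [Group H] : List GrpCat.{0} → Prop
  | [] => Subsingleton H
  | G₀ :: l => IsIteratedCentralProductFrom d H G₀ l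

/-- The list `E(d, j₁), …, E(d, jₙ), A`. -/
def factorList (d : ℕ) {n : ℕ} (j : Fin n → ℕ) (A : Type) [CommGroup A] : List GrpCat.{0} :=
  List.ofFn (fun k => GrpCat.of (E d (j k))) ++ [GrpCat.of A]

/-- `G` belongs to `𝒮_{n,m}` (for positive `n` and `m`). -/
def MemS (n m : ℕ) (G : Type*) [Group G] : Prop :=
  Finite G ∧ ∃ d : ℕ, 0 < d ∧ ∃ j : Fin n → ℕ, (∀ k, j k < d) ∧
    ∃ (A : Type) (_ : CommGroup A), MemA m d A ∧
      IsIteratedCentralProduct d G (factorList d j A)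

/-- `S` belongs to `𝒮_I^r`: it embeds in a direct product of `r` groups from
`⋃_{(n,m) ∈ I} 𝒮_{n,m}`. -/
def MemSProd (I : Set (ℕ × ℕ)) (r : ℕ) (S : Type*) [Group S] : Prop :=
  ∃ G : Fin r → GrpCat.{0}, (∀ i, ∃ nm ∈ I, MemS nm.1 nm.2 (G i)) ∧
    ∃ f : S →* (∀ i, G i), Function.Injective f

end SpecialGroups

/-! The commutator map of a group `T` whose commutator subgroup `T'` is central of order `p` and
contains all `p`-th powers is an alternating `𝔽_p`-bilinear form on `T / T'`. A pair of
non-commuting elements spans a hyperbolic plane, and after a change of basis it generates a copy of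
`E(p, 0)` or `E(p, 1)`. Splitting off such planes until the orthogonal complement is abelian
exhibits `T` as an iterated central product. A special group `S` is treated through its quotients
`S / K` by the hyperplanes `K` of the `𝔽_p`-vector space `Z(S)`. -/

namespace SpecialGroups

open Subgroup (center centralizer closure zpowers)
open scoped commutatorElement

section Commutators

variable {G : Type*} [Group G] {x y z : G}

theorem groupComm_eq_one_iff : groupComm x y = 1 ↔ Commute x y := by
  rw [groupComm, mul_assoc, ← mul_inv_rev, inv_mul_eq_one]
  exact eq_comm

theorem groupComm_mem_commutator (x y : G) : groupComm x y ∈ commutator G := by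
  have h : groupComm x y = ⁅x⁻¹, y⁻¹⁆ := by simp [groupComm, commutatorElement_def]
  exact h ▸ Subgroup.commutator_mem_commutator (Subgroup.mem_top _) (Subgroup.mem_top _)

@[simp]
theorem groupComm_self (x : G) : groupComm x x = 1 :=
  groupComm_eq_one_iff.2 (Commute.refl x)

theorem mul_eq_mul_mul_groupComm (x y : G) : x * y = y * x * groupComm x y := by
  simp [groupComm, mul_assoc]

theorem map_groupComm {H : Type*} [Group H] (f : G →* H) (x y : G) :
    f (groupComm x y) = groupComm (f x) (f y) := by
  simp [groupComm]

theorem groupComm_mul_left (h : groupComm x z ∈ center G) :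
    groupComm (x * y) z = groupComm x z * groupComm y z := by
  calc groupComm (x * y) z = y⁻¹ * groupComm x z * (z⁻¹ * y * z) := by simp [groupComm, mul_assoc]
    _ = groupComm x z * groupComm y z := by
      rw [Subgroup.mem_center_iff.1 h]; simp [groupComm, mul_assoc]

theorem groupComm_pow_left (h : groupComm x y ∈ center G) (n : ℕ) :
    groupComm (x ^ n) y = groupComm x y ^ n := by
  induction n with
  | zero => simp [groupComm]
  | succ n ih => rw [pow_succ, groupComm_mul_left (ih ▸ pow_mem h n), ih, pow_succ]

theorem mul_pow_of_groupComm_mem_center (h : groupComm y x ∈ center G) (n : ℕ) :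
    (x * y) ^ n = x ^ n * y ^ n * groupComm y x ^ n.choose 2 := by
  have hc : ∀ (k : ℕ) (g : G), g * groupComm y x ^ k = groupComm y x ^ k * g :=
    fun k => Subgroup.mem_center_iff.1 (pow_mem h k)
  induction n with
  | zero => simp
  | succ n ih =>
    have hyx : y ^ n * x = x * y ^ n * groupComm y x ^ n := by
      rw [mul_eq_mul_mul_groupComm, groupComm_pow_left h]
    calc (x * y) ^ (n + 1) = x ^ n * (y ^ n * x) * y * groupComm y x ^ n.choose 2 := by
          rw [pow_succ, ih, mul_assoc (x ^ n * y ^ n), ← hc]; simp only [mul_assoc]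
      _ = x ^ (n + 1) * y ^ (n + 1) * (groupComm y x ^ n * groupComm y x ^ n.choose 2) := by
          rw [hyx, pow_succ x, pow_succ y, ← mul_assoc (x ^ n), mul_assoc _ _ y, ← hc]
          simp only [mul_assoc]
      _ = _ := by rw [← pow_add, Nat.choose_succ_succ' n 1, Nat.choose_one_right]

/-- The homomorphism `x ↦ [x, y]` of a group of nilpotency class at most two. -/
def commHom (hG : commutator G ≤ center G) (y : G) : G →* commutator G where
  toFun x := ⟨groupComm x y, groupComm_mem_commutator x y⟩
  map_one' := by simp [groupComm]
  map_mul' _ _ := Subtype.ext (groupComm_mul_left (hG (groupComm_mem_commutator _ _)))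

@[simp]
theorem coe_commHom (hG : commutator G ≤ center G) (x y : G) :
    (commHom hG y x : G) = groupComm x y := rfl

theorem ker_commHom (hG : commutator G ≤ center G) (y : G) :
    (commHom hG y).ker = centralizer {y} := by
  ext x
  rw [MonoidHom.mem_ker, Subgroup.mem_centralizer_singleton_iff, ← OneMemClass.coe_eq_one,
    coe_commHom, groupComm_eq_one_iff]
  rfl

theorem inv_mul_mem_centralizer_iff (hG : commutator G ≤ center G) :
    x⁻¹ * y ∈ centralizer {z} ↔ groupComm y z = groupComm x z := by
  rw [← ker_commHom hG, ← MonoidHom.eq_iff, Subtype.ext_iff, coe_commHom, coe_commHom]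

theorem groupComm_zpow_mul_zpow (hG : commutator G ≤ center G) (i k : ℤ) :
    groupComm (x ^ i * y ^ k) z = groupComm x z ^ i * groupComm y z ^ k := by
  have h : commHom hG z (x ^ i * y ^ k) = commHom hG z x ^ i * commHom hG z y ^ k := by simp
  exact congrArg Subtype.val h

theorem exists_eq_zpow_mul_zpow_mul_of_mem_closure_pair (h : x ∈ closure {y, z}) :
    ∃ i k : ℤ, ∃ t ∈ commutator G, x = y ^ i * z ^ k * t := by
  have hx : Abelianization.of x ∈ closure {Abelianization.of y, Abelianization.of z} := by
    rw [← Set.image_pair, ← MonoidHom.map_closure]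
    exact Subgroup.mem_map_of_mem _ h
  obtain ⟨i, k, hik⟩ := Subgroup.mem_closure_pair.1 hx
  refine ⟨i, k, (y ^ i * z ^ k)⁻¹ * x, ?_, by group⟩
  rw [← Abelianization.ker_of, MonoidHom.mem_ker]
  simp [← hik]

theorem commutator_eq_bot_of_closure_pair_eq_top (h : closure {x, y} = ⊤) (hxy : Commute x y) :
    commutator G = ⊥ := by
  have : IsMulCommutative (closure {x, y}) := Subgroup.isMulCommutative_closure (by
    rintro _ (rfl | rfl) _ (rfl | rfl) <;> first | rfl | exact hxy | exact hxy.symm)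
  rw [commutator_def, ← h, Subgroup.commutator_eq_bot_iff_le_centralizer]
  exact Subgroup.le_centralizer _

theorem commutator_eq_zpowers_of_closure_pair_eq_top (h : closure {x, y} = ⊤)
    (hxy : groupComm x y ∈ center G) : commutator G = zpowers (groupComm x y) := by
  refine le_antisymm ?_ (Subgroup.zpowers_le.2 (groupComm_mem_commutator x y))
  have hle : zpowers (groupComm x y) ≤ center G := Subgroup.zpowers_le.2 hxy
  have hN : (zpowers (groupComm x y)).Normal :=
    ⟨fun t ht g => by rwa [Subgroup.mem_center_iff.1 (hle ht), mul_inv_cancel_right]⟩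
  let π := QuotientGroup.mk' (zpowers (groupComm x y))
  have hcomm : Commute (π x) (π y) := by
    rw [← groupComm_eq_one_iff, ← map_groupComm]
    exact (QuotientGroup.eq_one_iff _).2 (Subgroup.mem_zpowers _)
  have hclosure : closure {π x, π y} = ⊤ := by
    rw [← Set.image_pair, ← MonoidHom.map_closure, h, ← MonoidHom.range_eq_map]
    exact QuotientGroup.range_mk' _
  exact Subgroup.Normal.quotient_commutative_iff_commutator_le.1
    ((commutator_eq_bot_iff _).1 (commutator_eq_bot_of_closure_pair_eq_top hclosure hcomm))

theorem commutator_inf_center_le_frattini : commutator G ⊓ center G ≤ frattini G := by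
  refine le_iInf₂ fun M hM => ?_
  rcases hM.le_iff.1 (le_sup_left : M ≤ M ⊔ center G) with hsup | hsup
  · have hnormal : M.Normal := Subgroup.normalizer_eq_top_iff.1 <|
      top_le_iff.1 (hsup ▸ sup_le Subgroup.le_normalizer (Subgroup.center_le_normalizer _))
    exact inf_le_left.trans
      (Subgroup.Normal.commutator_le_of_self_sup_commutative_eq_top hsup inferInstance)
  · exact inf_le_right.trans (hsup ▸ le_sup_right)

theorem isCoatom_of_index_prime {H : Subgroup G} (h : H.index.Prime) : IsCoatom H := by
  refine ⟨fun htop => h.ne_one (Subgroup.index_eq_one.2 htop), fun K hHK => ?_⟩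
  rcases h.eq_one_or_self_of_dvd _ (Dvd.intro_left _ (Subgroup.relIndex_mul_index hHK.le))
    with hK | hK
  · exact Subgroup.index_eq_one.1 hK
  · have := Subgroup.relIndex_mul_index hHK.le
    rw [hK, Nat.mul_eq_right h.ne_zero, Subgroup.relIndex_eq_one] at this
    exact absurd this hHK.not_ge

end Commutators

/-- The commutator subgroup is central of order `p` and contains all `p`-th powers. A finite
`p`-group has this property exactly when `Φ(T) = [T, T]` has order `p`; the centre of `T` may be
larger than `[T, T]`. -/
structure IsGeneralizedExtraspecial (p : ℕ) (T : Type*) [Group T] : Prop where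
  commutator_le_center : commutator T ≤ center T
  card_commutator : Nat.card (commutator T) = p
  pow_mem_commutator (x : T) : x ^ p ∈ commutator T

/-- `H / [T, T]` is a nondegenerate subspace of `T / [T, T]` for the commutator form. -/
structure IsNondegenerateFactor {T : Type*} [Group T] (H : Subgroup T) : Prop where
  commutator_le : commutator T ≤ H
  inf_centralizer_le : H ⊓ centralizer H ≤ commutator T
  sup_centralizer : H ⊔ centralizer (H : Set T) = ⊤

theorem centralizer_sup {G : Type*} [Group G] (H K : Subgroup G) :
    centralizer (H ⊔ K : Subgroup G) = centralizer (H : Set G) ⊓ centralizer K := by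
  rw [Subgroup.sup_eq_closure, Subgroup.centralizer_closure]
  exact SetLike.coe_injective Set.centralizer_union

theorem centralizer_closure_pair {G : Type*} [Group G] (a b : G) :
    centralizer (closure {a, b} : Set G) = centralizer {a} ⊓ centralizer {b} := by
  rw [Subgroup.centralizer_closure]
  exact SetLike.coe_injective Set.centralizer_union

theorem IsNondegenerateFactor.sup {T : Type*} [Group T] {H K : Subgroup T}
    (hH : IsNondegenerateFactor H) (hK : IsNondegenerateFactor K) (hKH : K ≤ centralizer H) :
    IsNondegenerateFactor (H ⊔ K) where
  commutator_le := hH.commutator_le.trans le_sup_left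
  inf_centralizer_le := by
    rw [centralizer_sup]
    rintro x ⟨hx, hxH, hxK⟩
    have := Subgroup.Normal.of_commutator_le _ hH.commutator_le
    obtain ⟨h, hh, k, hk, rfl⟩ := Subgroup.mem_sup_of_normal_left.1 hx
    have hhT : h ∈ commutator T := hH.inf_centralizer_le
      ⟨hh, (Subgroup.mul_mem_cancel_right _ (hKH hk)).1 hxH⟩
    exact hK.inf_centralizer_le ⟨mul_mem (hK.commutator_le hhT) hk, hxK⟩
  sup_centralizer := by
    have := Subgroup.Normal.of_commutator_le _ hK.commutator_le
    have hle : centralizer (H : Set T) ≤ K ⊔ centralizer H ⊓ centralizer K := by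
      intro c hc
      obtain ⟨k, hk, d, hd, rfl⟩ :=
        Subgroup.mem_sup_of_normal_left.1 (hK.sup_centralizer.ge (Subgroup.mem_top c))
      exact Subgroup.mul_mem_sup hk ⟨(Subgroup.mul_mem_cancel_left _ (hKH hk)).1 hc, hd⟩
    rw [centralizer_sup, sup_assoc, eq_top_iff, ← hH.sup_centralizer]
    exact sup_le_sup_left hle H

namespace IsGeneralizedExtraspecial

variable {p : ℕ} {T : Type*} [Group T] (hT : IsGeneralizedExtraspecial p T)

include hT

theorem groupComm_mem_center (x y : T) : groupComm x y ∈ center T :=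
  hT.commutator_le_center (groupComm_mem_commutator x y)

theorem pow_eq_one_of_mem_commutator {t : T} (ht : t ∈ commutator T) : t ^ p = 1 := by
  have h : (⟨t, ht⟩ : commutator T) ^ p = 1 := by rw [← hT.card_commutator, pow_card_eq_one']
  exact congrArg Subtype.val h

theorem isPGroup : IsPGroup p T := fun x =>
  ⟨2, by rw [sq, pow_mul, hT.pow_eq_one_of_mem_commutator (hT.pow_mem_commutator x)]⟩

variable [hp : Fact p.Prime]

theorem zpowers_eq_commutator {t : T} (ht : t ∈ commutator T) (h1 : t ≠ 1) :
    zpowers t = commutator T := by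
  have : Finite (commutator T) := Nat.finite_of_card_ne_zero (hT.card_commutator ▸ hp.out.ne_zero)
  refine Subgroup.eq_of_le_of_card_ge ((Subgroup.zpowers_le).2 ht) ?_
  rw [hT.card_commutator, Nat.card_zpowers,
    orderOf_eq_prime (hT.pow_eq_one_of_mem_commutator ht) h1]

variable {a b : T}

section NonCommuting

variable (hab : ¬ Commute a b)

include hab

theorem exists_groupComm_zpow_eq {t : T} (ht : t ∈ commutator T) :
    ∃ k : ℤ, groupComm a b ^ k = t := by
  rwa [← Subgroup.mem_zpowers_iff, hT.zpowers_eq_commutator (groupComm_mem_commutator a b)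
    (mt groupComm_eq_one_iff.1 hab)]

theorem exists_mem_closure_pair_groupComm_eq {s t : T} (hs : s ∈ commutator T)
    (ht : t ∈ commutator T) :
    ∃ x ∈ closure {a, b}, groupComm x a = s ∧ groupComm x b = t := by
  obtain ⟨k, hk⟩ := hT.exists_groupComm_zpow_eq (mt Commute.symm hab) hs
  obtain ⟨i, hi⟩ := hT.exists_groupComm_zpow_eq hab ht
  refine ⟨a ^ i * b ^ k, ?_, ?_, ?_⟩
  · exact mul_mem (zpow_mem (Subgroup.subset_closure (by simp)) i)
      (zpow_mem (Subgroup.subset_closure (by simp)) k)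
  · rw [groupComm_zpow_mul_zpow hT.commutator_le_center, groupComm_self, one_zpow, one_mul, hk]
  · rw [groupComm_zpow_mul_zpow hT.commutator_le_center, groupComm_self, one_zpow, mul_one, hi]

theorem index_centralizer_closure_pair :
    (centralizer (closure {a, b} : Set T)).index = p ^ 2 := by
  let χ := (commHom hT.commutator_le_center a).prod (commHom hT.commutator_le_center b)
  have hker : χ.ker = centralizer (closure {a, b}) := by
    rw [MonoidHom.ker_prod, ker_commHom, ker_commHom, centralizer_closure_pair]
  have hsurj : χ.range = ⊤ := by
    rw [MonoidHom.range_eq_top]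
    rintro ⟨s, t⟩
    obtain ⟨x, -, hs, ht⟩ := hT.exists_mem_closure_pair_groupComm_eq hab s.2 t.2
    exact ⟨x, Prod.ext (Subtype.ext hs) (Subtype.ext ht)⟩
  rw [← hker, Subgroup.index_ker, hsurj, Subgroup.card_top, Nat.card_prod, hT.card_commutator,
    sq]

theorem zpow_mem_commutator_of_groupComm_zpow_eq_one {k : ℤ} (h : groupComm a b ^ k = 1) (x : T) :
    x ^ k ∈ commutator T := by
  rw [← orderOf_dvd_iff_zpow_eq_one, orderOf_eq_prime
    (hT.pow_eq_one_of_mem_commutator (groupComm_mem_commutator a b))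
    (mt groupComm_eq_one_iff.1 hab)] at h
  obtain ⟨i, rfl⟩ := h
  rw [zpow_mul, zpow_natCast]
  exact zpow_mem (hT.pow_mem_commutator x) i

theorem isNondegenerateFactor_closure_pair : IsNondegenerateFactor (closure {a, b}) where
  commutator_le := by
    rw [← hT.zpowers_eq_commutator (groupComm_mem_commutator a b)
      (mt groupComm_eq_one_iff.1 hab), Subgroup.zpowers_le]
    have ha : a ∈ closure {a, b} := Subgroup.subset_closure (by simp)
    have hb : b ∈ closure {a, b} := Subgroup.subset_closure (by simp)
    exact mul_mem (mul_mem (mul_mem (inv_mem ha) (inv_mem hb)) ha) hb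
  inf_centralizer_le := by
    rintro x ⟨hx, hxc⟩
    obtain ⟨i, k, t, ht, rfl⟩ := exists_eq_zpow_mul_zpow_mul_of_mem_closure_pair hx
    have hT' := hT.commutator_le_center
    have hab' : a ^ i * b ^ k ∈ centralizer (closure {a, b}) :=
      (Subgroup.mul_mem_cancel_right _ (Subgroup.center_le_centralizer _ (hT' ht))).1 hxc
    have hcomm : ∀ c ∈ closure {a, b}, groupComm (a ^ i * b ^ k) c = 1 := fun c hc =>
      groupComm_eq_one_iff.2 (Subgroup.mem_centralizer_iff.1 hab' c hc).symm
    have hb : groupComm a b ^ i = 1 := by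
      simpa [groupComm_zpow_mul_zpow hT'] using hcomm b (Subgroup.subset_closure (by simp))
    have ha : groupComm b a ^ k = 1 := by
      simpa [groupComm_zpow_mul_zpow hT'] using hcomm a (Subgroup.subset_closure (by simp))
    exact mul_mem (mul_mem
      (hT.zpow_mem_commutator_of_groupComm_zpow_eq_one hab hb a)
      (hT.zpow_mem_commutator_of_groupComm_zpow_eq_one (mt Commute.symm hab) ha b)) ht
  sup_centralizer := by
    refine top_le_iff.1 fun g _ => ?_
    obtain ⟨x, hx, hxa, hxb⟩ := hT.exists_mem_closure_pair_groupComm_eq hab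
      (groupComm_mem_commutator g a) (groupComm_mem_commutator g b)
    have hker : x⁻¹ * g ∈ centralizer (closure {a, b}) := by
      rw [centralizer_closure_pair, Subgroup.mem_inf,
        inv_mul_mem_centralizer_iff hT.commutator_le_center,
        inv_mul_mem_centralizer_iff hT.commutator_le_center]
      exact ⟨hxa.symm, hxb.symm⟩
    simpa using Subgroup.mul_mem_sup hx hker

end NonCommuting

theorem commutator_ne_bot : commutator T ≠ ⊥ := by
  rw [ne_eq, ← Subgroup.card_eq_one, hT.card_commutator]
  exact hp.out.ne_one

theorem frattini_le_center : frattini T ≤ center T := by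
  refine fun x hx => Subgroup.mem_center_iff.2 fun y => ?_
  by_cases hy : (centralizer {y}).index = 1
  · rw [Subgroup.index_eq_one] at hy
    exact Subgroup.mem_centralizer_singleton_iff.1 (hy ▸ Subgroup.mem_top x) |>.symm
  have hdvd : (centralizer {y}).index ∣ Nat.card (commutator T) := by
    rw [← ker_commHom hT.commutator_le_center, Subgroup.index_ker]
    exact Subgroup.card_subgroup_dvd_card _
  rw [hT.card_commutator] at hdvd
  have hprime : (centralizer {y}).index.Prime :=
    ((Nat.dvd_prime hp.out).1 hdvd).resolve_left hy ▸ hp.out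
  exact (Subgroup.mem_centralizer_singleton_iff.1
    (frattini_le_coatom (isCoatom_of_index_prime hprime) hx)).symm

section TwoGenerated

variable (h : closure {a, b} = ⊤)

include h

theorem not_commute_of_closure_pair_eq_top : ¬ Commute a b := fun hab =>
  hT.commutator_ne_bot (commutator_eq_bot_of_closure_pair_eq_top h hab)

theorem center_eq_commutator : center T = commutator T := by
  refine le_antisymm ?_ hT.commutator_le_center
  have := (hT.isNondegenerateFactor_closure_pair
    (hT.not_commute_of_closure_pair_eq_top h)).inf_centralizer_le
  rwa [h, Subgroup.coe_top, Subgroup.centralizer_univ, top_inf_eq] at this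

theorem card_eq_pow_three : Nat.card T = p ^ 3 := by
  have := hT.index_centralizer_closure_pair (hT.not_commute_of_closure_pair_eq_top h)
  rw [h, Subgroup.coe_top, Subgroup.centralizer_univ] at this
  rw [← (center T).card_mul_index, this, hT.center_eq_commutator h, hT.card_commutator]
  ring

theorem isExtraSpecial : IsExtraSpecial p T := by
  have hcenter := hT.center_eq_commutator h
  have hfrattini : frattini T = center T := by
    refine le_antisymm hT.frattini_le_center ?_
    rw [hcenter]
    exact (le_inf le_rfl hT.commutator_le_center).trans commutator_inf_center_le_frattini
  have hfin : Finite T := Nat.finite_of_card_ne_zero (by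
    rw [hT.card_eq_pow_three h]; exact pow_ne_zero _ hp.out.ne_zero)
  refine ⟨⟨hfin, hT.isPGroup, Or.inr ⟨hfrattini, hcenter, ?_, ?_⟩⟩,
    fun hcomm => hT.not_commute_of_closure_pair_eq_top h (hcomm a b), ?_⟩
  · exact fun x y => Subtype.ext (Subgroup.mem_center_iff.1 (hT.frattini_le_center y.2) x)
  · exact fun x => Subtype.ext (hT.pow_eq_one_of_mem_commutator
      (hcenter ▸ hT.frattini_le_center x.2))
  · exact isCyclic_of_prime_card (p := p) (by rw [hcenter, hT.card_commutator])

theorem injective_of_not_commutator_le_ker {H : Type*} [Group H] (f : T →* H)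
    (hf : ¬ commutator T ≤ f.ker) : Function.Injective f := by
  have hbot : ∀ t ∈ commutator T, f t = 1 → t = 1 := fun t ht h1 => by
    by_contra hne
    exact hf (hT.zpowers_eq_commutator ht hne ▸ Subgroup.zpowers_le.2 h1)
  refine (injective_iff_map_eq_one f).2 fun x hx => hbot x ?_ hx
  rw [← hT.center_eq_commutator h, Subgroup.mem_center_iff]
  refine fun y => (groupComm_eq_one_iff.1 (hbot _ (groupComm_mem_commutator y x) ?_)).eq
  rw [map_groupComm, hx, groupComm_eq_one_iff]
  exact Commute.one_right _

end TwoGenerated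

end IsGeneralizedExtraspecial

/-- The pair `(a, b)`, together with `[a, b]` in the place of `γ`, satisfies the defining relations
of `E(d, j)`. -/
structure IsHeisenbergPair {G : Type*} [Group G] (d j : ℕ) (a b : G) : Prop where
  left_pow : a ^ d = groupComm a b ^ j
  right_pow : b ^ d = groupComm a b ^ j
  groupComm_pow : groupComm a b ^ d = 1
  commute_left : Commute a (groupComm a b)
  commute_right : Commute b (groupComm a b)

/-- `H` contains a non-commuting pair which satisfies the relations of `E(p, 0)` or `E(p, 1)`. -/
def HasHeisenbergPair {G : Type*} [Group G] (p : ℕ) (H : Subgroup G) : Prop :=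
  ∃ a ∈ H, ∃ b ∈ H, ¬ Commute a b ∧ ∃ j, (j = 0 ∨ j = 1) ∧ IsHeisenbergPair p j a b

namespace IsGeneralizedExtraspecial

variable {p : ℕ} {T : Type*} [Group T] {x y : T}

theorem isHeisenbergPair (hT : IsGeneralizedExtraspecial p T) {j : ℕ}
    (hx : x ^ p = groupComm x y ^ j) (hy : y ^ p = groupComm x y ^ j) :
    IsHeisenbergPair p j x y where
  left_pow := hx
  right_pow := hy
  groupComm_pow := hT.pow_eq_one_of_mem_commutator (groupComm_mem_commutator x y)
  commute_left := Subgroup.mem_center_iff.1 (hT.groupComm_mem_center x y) x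
  commute_right := Subgroup.mem_center_iff.1 (hT.groupComm_mem_center x y) y

section OddPrime

variable [hp : Fact p.Prime] (hT : IsGeneralizedExtraspecial p T)

include hT

theorem mul_pow_of_two_lt (h2 : 2 < p) (x y : T) : (x * y) ^ p = x ^ p * y ^ p := by
  have hdvd : p ∣ p.choose 2 := hp.out.dvd_choose_self two_ne_zero h2
  obtain ⟨k, hk⟩ := hdvd
  rw [mul_pow_of_groupComm_mem_center (hT.groupComm_mem_center y x), hk, pow_mul,
    hT.pow_eq_one_of_mem_commutator (groupComm_mem_commutator y x), one_pow, mul_one]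

theorem hasHeisenbergPair_of_pow_ne_one (h2 : 2 < p) (hxy : ¬ Commute x y) (hy : y ^ p ≠ 1) :
    HasHeisenbergPair p (closure {x, y}) := by
  have hx' := hT.pow_mem_commutator x
  have hy' := hT.pow_mem_commutator y
  obtain ⟨v, hv⟩ := hT.exists_groupComm_zpow_eq hxy hy'
  obtain ⟨w, hw⟩ : ∃ w : ℤ, (y ^ p) ^ w = ((x ^ p) ^ v)⁻¹ * y ^ p := by
    rw [← Subgroup.mem_zpowers_iff, hT.zpowers_eq_commutator hy' hy]
    exact mul_mem (inv_mem (zpow_mem hx' v)) hy'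
  have hpow : (x ^ v * y ^ w) ^ p = y ^ p := by
    rw [hT.mul_pow_of_two_lt h2, ← zpow_natCast, ← zpow_natCast, zpow_comm, zpow_comm y,
      zpow_natCast, zpow_natCast, hw, mul_inv_cancel_left]
  have hcomm : groupComm (x ^ v * y ^ w) y = y ^ p := by
    simp [groupComm_zpow_mul_zpow hT.commutator_le_center, hv]
  have hmem {z : T} (hz : z ∈ ({x, y} : Set T)) : z ∈ closure {x, y} := Subgroup.subset_closure hz
  refine ⟨x ^ v * y ^ w, mul_mem (zpow_mem (hmem (by simp)) v) (zpow_mem (hmem (by simp)) w),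
    y, hmem (by simp), ?_, 1, Or.inr rfl, hT.isHeisenbergPair ?_ ?_⟩
  · rwa [← groupComm_eq_one_iff, hcomm]
  · rw [hpow, hcomm, pow_one]
  · rw [hcomm, pow_one]

theorem hasHeisenbergPair_of_two_lt (h2 : 2 < p) (hxy : ¬ Commute x y) :
    HasHeisenbergPair p (closure {x, y}) := by
  by_cases hy : y ^ p = 1
  · by_cases hx : x ^ p = 1
    · exact ⟨x, Subgroup.subset_closure (by simp), y, Subgroup.subset_closure (by simp), hxy,
        0, Or.inl rfl, hT.isHeisenbergPair (by simpa) (by simpa)⟩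
    · rw [Set.pair_comm]
      exact hT.hasHeisenbergPair_of_pow_ne_one h2 (mt Commute.symm hxy) hx
  · exact hT.hasHeisenbergPair_of_pow_ne_one h2 hxy hy

end OddPrime

theorem sq_eq_one_or_eq_groupComm (hT : IsGeneralizedExtraspecial 2 T) (hxy : ¬ Commute x y)
    (z : T) : z ^ 2 = 1 ∨ z ^ 2 = groupComm x y := by
  refine or_iff_not_imp_left.2 fun hz => ?_
  obtain ⟨t, -, ht⟩ := (Nat.card_eq_two_iff' (1 : commutator T)).1 hT.card_commutator
  have hunique {u : T} (hu : u ∈ commutator T) (h1 : u ≠ 1) : u = t :=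
    congrArg Subtype.val (ht ⟨u, hu⟩ (mt (congrArg Subtype.val) h1))
  rw [hunique (hT.pow_mem_commutator z) hz,
    hunique (groupComm_mem_commutator x y) (mt groupComm_eq_one_iff.1 hxy)]

theorem hasHeisenbergPair_of_sq_eq_one (hT : IsGeneralizedExtraspecial 2 T) (hxy : ¬ Commute x y)
    (hy : y ^ 2 = 1) : HasHeisenbergPair 2 (closure {x, y}) := by
  have hx_mem : x ∈ closure {x, y} := Subgroup.subset_closure (by simp)
  have hy_mem : y ∈ closure {x, y} := Subgroup.subset_closure (by simp)
  rcases hT.sq_eq_one_or_eq_groupComm (mt Commute.symm hxy) x with hx | hx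
  · exact ⟨x, hx_mem, y, hy_mem, hxy, 0, Or.inl rfl, hT.isHeisenbergPair (by simpa) (by simpa)⟩
  · have hxy_sq : (x * y) ^ 2 = 1 := by
      rw [mul_pow_of_groupComm_mem_center (hT.groupComm_mem_center y x), hx, hy, mul_one,
        Nat.choose_self, pow_one, ← sq,
        hT.pow_eq_one_of_mem_commutator (groupComm_mem_commutator y x)]
    refine ⟨x * y, mul_mem hx_mem hy_mem, y, hy_mem, ?_, 0, Or.inl rfl,
      hT.isHeisenbergPair (by simpa) (by simpa)⟩
    rwa [← groupComm_eq_one_iff, groupComm_mul_left (hT.groupComm_mem_center x y), groupComm_self,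
      mul_one, groupComm_eq_one_iff]

theorem hasHeisenbergPair_of_two (hT : IsGeneralizedExtraspecial 2 T) (hxy : ¬ Commute x y) :
    HasHeisenbergPair 2 (closure {x, y}) := by
  rcases hT.sq_eq_one_or_eq_groupComm hxy y with hy | hy
  · exact hT.hasHeisenbergPair_of_sq_eq_one hxy hy
  rcases hT.sq_eq_one_or_eq_groupComm hxy x with hx | hx
  · rw [Set.pair_comm]
    exact hT.hasHeisenbergPair_of_sq_eq_one (mt Commute.symm hxy) hx
  · exact ⟨x, Subgroup.subset_closure (by simp), y, Subgroup.subset_closure (by simp), hxy, 1,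
      Or.inr rfl, hT.isHeisenbergPair (by rwa [pow_one]) (by rwa [pow_one])⟩

theorem hasHeisenbergPair [hp : Fact p.Prime] (hT : IsGeneralizedExtraspecial p T)
    (hxy : ¬ Commute x y) : HasHeisenbergPair p (closure {x, y}) := by
  obtain rfl | h2 := hp.out.two_le.eq_or_lt
  · exact hT.hasHeisenbergPair_of_two hxy
  · exact hT.hasHeisenbergPair_of_two_lt h2 hxy

end IsGeneralizedExtraspecial

namespace E

variable {d j : ℕ}

/-- The generator `α` of `E(d, j)`. -/
def α (d j : ℕ) : E d j := PresentedGroup.of Gen.α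

/-- The generator `β` of `E(d, j)`. -/
def β (d j : ℕ) : E d j := PresentedGroup.of Gen.β

theorem groupComm_α_β (d j : ℕ) : groupComm (α d j) (β d j) = PresentedGroup.of Gen.γ := by
  have h := PresentedGroup.one_of_mem (rels := relators d j)
    (x := groupComm (FreeGroup.of Gen.α) (FreeGroup.of Gen.β) * (FreeGroup.of Gen.γ)⁻¹)
    (by simp [relators])
  rwa [map_mul, map_inv, map_groupComm, mul_inv_eq_one] at h

theorem isHeisenbergPair_α_β (d j : ℕ) : IsHeisenbergPair d j (α d j) (β d j) := by
  have relation (r) (hr : r ∈ relators d j := by simp [relators]) : PresentedGroup.mk _ r = 1 :=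
    PresentedGroup.one_of_mem hr
  have hα := relation (FreeGroup.of Gen.α ^ d * (FreeGroup.of Gen.γ ^ j)⁻¹)
  have hβ := relation (FreeGroup.of Gen.β ^ d * (FreeGroup.of Gen.γ ^ j)⁻¹)
  have hγ := relation (FreeGroup.of Gen.γ ^ d)
  have hαγ := relation (groupComm (FreeGroup.of Gen.α) (FreeGroup.of Gen.γ))
  have hβγ := relation (groupComm (FreeGroup.of Gen.β) (FreeGroup.of Gen.γ))
  rw [map_mul, map_inv, map_pow, map_pow, mul_inv_eq_one] at hα hβ
  rw [map_pow] at hγ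
  rw [map_groupComm, groupComm_eq_one_iff] at hαγ hβγ
  constructor <;> rw [groupComm_α_β] <;> assumption

theorem closure_α_β (d j : ℕ) : closure {α d j, β d j} = ⊤ := by
  rw [eq_top_iff, ← PresentedGroup.closure_range_of, Subgroup.closure_le]
  have hα : α d j ∈ closure {α d j, β d j} := Subgroup.subset_closure (by simp)
  have hβ : β d j ∈ closure {α d j, β d j} := Subgroup.subset_closure (by simp)
  rintro _ ⟨g, rfl⟩
  cases g
  · exact hα
  · exact hβ
  · rw [← groupComm_α_β]
    exact mul_mem (mul_mem (mul_mem (inv_mem hα) (inv_mem hβ)) hα) hβ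

theorem groupComm_α_β_mem_center (d j : ℕ) : groupComm (α d j) (β d j) ∈ center (E d j) := by
  have h := isHeisenbergPair_α_β d j
  have hle : closure {α d j, β d j} ≤ centralizer {groupComm (α d j) (β d j)} := by
    rw [Subgroup.closure_le]
    rintro _ (rfl | rfl)
    · exact Subgroup.mem_centralizer_singleton_iff.2 h.commute_left
    · exact Subgroup.mem_centralizer_singleton_iff.2 h.commute_right
  rw [closure_α_β] at hle
  exact Subgroup.mem_center_iff.2 fun g =>
    Subgroup.mem_centralizer_singleton_iff.1 (hle (Subgroup.mem_top g))

theorem commutator_eq_zpowers (d j : ℕ) :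
    commutator (E d j) = zpowers (groupComm (α d j) (β d j)) :=
  commutator_eq_zpowers_of_closure_pair_eq_top (closure_α_β d j) (groupComm_α_β_mem_center d j)

theorem pow_mem_commutator (x : E d j) : x ^ d ∈ commutator (E d j) := by
  have hγ : (Abelianization.of (groupComm (α d j) (β d j))) = 1 :=
    (Abelianization.ker_of _).ge (groupComm_mem_commutator _ _)
  have hα : Abelianization.of (α d j) ^ d = 1 := by
    rw [← map_pow, (isHeisenbergPair_α_β d j).left_pow, map_pow, hγ, one_pow]
  have hβ : Abelianization.of (β d j) ^ d = 1 := by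
    rw [← map_pow, (isHeisenbergPair_α_β d j).right_pow, map_pow, hγ, one_pow]
  obtain ⟨i, k, t, ht, rfl⟩ := exists_eq_zpow_mul_zpow_mul_of_mem_closure_pair
    ((closure_α_β d j).ge (Subgroup.mem_top x))
  rw [← Abelianization.ker_of, MonoidHom.mem_ker] at ht ⊢
  rw [map_pow, map_mul, map_mul, map_zpow, map_zpow, ht, mul_one, mul_pow, ← zpow_natCast,
    ← zpow_natCast, zpow_comm, zpow_comm _ k, zpow_natCast, zpow_natCast, hα, hβ, one_zpow,
    one_zpow, mul_one]

theorem isGeneralizedExtraspecial {p j : ℕ} [hp : Fact p.Prime]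
    (h : groupComm (α p j) (β p j) ≠ 1) : IsGeneralizedExtraspecial p (E p j) where
  commutator_le_center := by
    rw [commutator_eq_zpowers, Subgroup.zpowers_le]
    exact groupComm_α_β_mem_center p j
  card_commutator := by
    rw [commutator_eq_zpowers, Nat.card_zpowers]
    exact orderOf_eq_prime (isHeisenbergPair_α_β p j).groupComm_pow h
  pow_mem_commutator := pow_mem_commutator

variable {G : Type*} [Group G] {a b : G}

/-- The homomorphism `α ↦ a`, `β ↦ b`. -/
def lift (h : IsHeisenbergPair d j a b) : E d j →* G :=
  PresentedGroup.toGroup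
    (f := fun | Gen.α => a | Gen.β => b | Gen.γ => groupComm a b) <| by
      have ha := groupComm_eq_one_iff.2 h.commute_left
      have hb := groupComm_eq_one_iff.2 h.commute_right
      rintro r (rfl | rfl | rfl | rfl | rfl | rfl) <;>
        simp [map_groupComm, h.left_pow, h.right_pow, h.groupComm_pow, ha, hb]

@[simp]
theorem lift_α (h : IsHeisenbergPair d j a b) : lift h (α d j) = a := PresentedGroup.toGroup.of _

@[simp]
theorem lift_β (h : IsHeisenbergPair d j a b) : lift h (β d j) = b := PresentedGroup.toGroup.of _

theorem lift_groupComm (h : IsHeisenbergPair d j a b) :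
    lift h (groupComm (α d j) (β d j)) = groupComm a b := by
  rw [map_groupComm, lift_α, lift_β]

theorem range_lift (h : IsHeisenbergPair d j a b) : (lift h).range = closure {a, b} := by
  rw [MonoidHom.range_eq_map, ← closure_α_β, MonoidHom.map_closure, Set.image_pair, lift_α, lift_β]

end E

namespace IsHeisenbergPair

variable {p j : ℕ} [Fact p.Prime] {G : Type*} [Group G] {a b : G}

theorem isGeneralizedExtraspecial (h : IsHeisenbergPair p j a b)
    (hab : ¬ Commute a b) : IsGeneralizedExtraspecial p (E p j) := by
  refine E.isGeneralizedExtraspecial fun h1 => hab ?_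
  rw [← groupComm_eq_one_iff, ← E.lift_groupComm h, h1, map_one]

theorem lift_injective (h : IsHeisenbergPair p j a b) (hab : ¬ Commute a b) :
    Function.Injective (E.lift h) := by
  refine (h.isGeneralizedExtraspecial hab).injective_of_not_commutator_le_ker
    (E.closure_α_β p j) _ fun hker => hab ?_
  rw [← groupComm_eq_one_iff, ← E.lift_groupComm h]
  exact hker (groupComm_mem_commutator _ _)

end IsHeisenbergPair

namespace CentralIso

variable {G₀ G₁ : Type*} [Group G₀] [Group G₁]

theorem coe_target (φ : CentralIso G₀ G₁) :
    (φ.target : Set G₁) = Set.range fun z => (φ.equiv z : G₁) := by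
  refine Eq.trans ?_ (φ.equiv.surjective.range_comp Subtype.val).symm
  exact Subtype.range_coe.symm

theorem eq_of_extends_of_source_le {ψ φ : CentralIso G₀ G₁} (h : ψ.Extends φ)
    (hs : ψ.source ≤ φ.source) : ψ = φ := by
  obtain ⟨hle, h⟩ := h
  have hψ := ψ.coe_target
  have hφ := φ.coe_target
  obtain ⟨s, t, _, _, e⟩ := ψ
  obtain ⟨s', t', _, _, e'⟩ := φ
  obtain rfl : s = s' := le_antisymm hs hle
  have hval : (fun z => (e z : G₁)) = fun z => (e' z : G₁) := funext h
  obtain rfl : t = t' := SetLike.coe_injective (hψ.trans (hval ▸ hφ.symm))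
  congr
  exact MulEquiv.ext fun z => Subtype.ext (h z)

section OfCommute

variable {T : Type*} [Group T] {f₀ : G₀ →* T} {f₁ : G₁ →* T}

/-- The isomorphism `f₀⁻¹(f₁(G₁)) ≃ f₀(G₀) ∩ f₁(G₁)` induced by an injective `f₀`. -/
noncomputable def comapRangeEquiv (f₁ : G₁ →* T) (h₀ : Function.Injective f₀) :
    f₁.range.comap f₀ ≃* (f₀.range ⊓ f₁.range : Subgroup T) :=
  (Subgroup.equivMapOfInjective _ f₀ h₀).trans
    (MulEquiv.subgroupCongr (Subgroup.map_comap_eq f₀ f₁.range))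

theorem comap_range_le_center (h₀ : Function.Injective f₀) (hcomm : ∀ x y, Commute (f₀ x) (f₁ y)) :
    f₁.range.comap f₀ ≤ center G₀ := by
  rintro x ⟨y, hy⟩
  refine Subgroup.mem_center_iff.2 fun g => h₀ ?_
  rw [map_mul, map_mul, ← hy, (hcomm g y).eq]

variable (h₀ : Function.Injective f₀) (h₁ : Function.Injective f₁)
  (hcomm : ∀ x y, Commute (f₀ x) (f₁ y))

/-- The identification of `f₀⁻¹(f₁(G₁))` with `f₁⁻¹(f₀(G₀))` in `T`. Its central product is the
internal central product `f₀(G₀) f₁(G₁)`. -/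
noncomputable def ofCommute : CentralIso G₀ G₁ where
  source := f₁.range.comap f₀
  target := f₀.range.comap f₁
  source_le := comap_range_le_center h₀ hcomm
  target_le := comap_range_le_center h₁ fun y x => (hcomm x y).symm
  equiv := (comapRangeEquiv f₁ h₀).trans
    ((MulEquiv.subgroupCongr (inf_comm _ _)).trans (comapRangeEquiv f₀ h₁).symm)

theorem map_ofCommute_equiv (z : (ofCommute h₀ h₁ hcomm).source) :
    f₁ ((ofCommute h₀ h₁ hcomm).equiv z) = f₀ z := by
  have h := (comapRangeEquiv f₀ h₁).apply_symm_apply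
    (MulEquiv.subgroupCongr (inf_comm _ _) (comapRangeEquiv f₁ h₀ z))
  exact congrArg Subtype.val h

theorem kernel_ofCommute :
    (ofCommute h₀ h₁ hcomm).kernel = (f₀.noncommCoprod f₁ hcomm).ker := by
  ext ⟨x, y⟩
  rw [MonoidHom.mem_ker, MonoidHom.noncommCoprod_apply]
  constructor
  · rintro ⟨z, hz⟩
    obtain ⟨rfl, rfl⟩ := Prod.mk.inj hz
    simp only [map_inv, map_ofCommute_equiv, mul_inv_cancel]
  · intro h
    have hx : f₁ y⁻¹ = f₀ x := by rw [map_inv, eq_comm, ← mul_eq_one_iff_eq_inv, h]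
    refine ⟨⟨x, y⁻¹, hx⟩, Prod.ext rfl (h₁ ?_)⟩
    rw [map_inv, map_ofCommute_equiv, ← hx, map_inv, inv_inv]

theorem isMaximal_ofCommute (hcenter : (center G₀).map f₀ ≤ f₁.range) :
    (ofCommute h₀ h₁ hcomm).IsMaximal := fun ψ hψ =>
  eq_of_extends_of_source_le hψ (ψ.source_le.trans (Subgroup.map_le_iff_le_comap.1 hcenter))

/-- The embedding of the central product onto `f₀(G₀) f₁(G₁)`. -/
noncomputable def ofCommuteHom : (ofCommute h₀ h₁ hcomm).CentralProduct →* T :=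
  QuotientGroup.lift _ (f₀.noncommCoprod f₁ hcomm) (kernel_ofCommute h₀ h₁ hcomm).le

theorem ofCommuteHom_injective : Function.Injective (ofCommuteHom h₀ h₁ hcomm) := by
  rw [← MonoidHom.ker_eq_bot_iff, ofCommuteHom, QuotientGroup.ker_lift, ← kernel_ofCommute h₀ h₁]
  exact QuotientGroup.map_mk'_self _

theorem range_ofCommuteHom : (ofCommuteHom h₀ h₁ hcomm).range = f₀.range ⊔ f₁.range := by
  rw [← MonoidHom.noncommCoprod_range f₀ f₁ hcomm]
  exact SetLike.coe_injective (Quotient.mk''_surjective.range_comp (ofCommuteHom h₀ h₁ hcomm)).symm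

end OfCommute

end CentralIso

section AbelianGroups

variable {ι : Type*} {n : ι → ℕ}

theorem closure_range_mulSingle_ofAdd_one [Finite ι] [DecidableEq ι] :
    Subgroup.closure (Set.range fun i : ι =>
      Pi.mulSingle i (Multiplicative.ofAdd (1 : ZMod (n i)))) = ⊤ := by
  have := Fintype.ofFinite ι
  refine (Subgroup.eq_top_iff' _).2 fun x => ?_
  rw [← Finset.univ_prod_mulSingle x]
  refine Subgroup.prod_mem _ fun i _ => ?_
  obtain ⟨k, hk⟩ := ZMod.intCast_surjective (x i).toAdd
  have hx : x i = Multiplicative.ofAdd (1 : ZMod (n i)) ^ k := by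
    rw [← ofAdd_zsmul, zsmul_one, hk, ofAdd_toAdd]
  rw [hx, Pi.mulSingle_zpow]
  exact zpow_mem (Subgroup.subset_closure (Set.mem_range_self i)) k

theorem dvd_of_mulEquiv_pi {A : Type*} [Monoid A] (e : A ≃* ∀ i, Multiplicative (ZMod (n i)))
    {q : ℕ} (h : ∀ x : A, x ^ q = 1) (i : ι) : n i ∣ q := by
  have hi := congrFun (congrArg e (h (e.symm fun _ => Multiplicative.ofAdd 1))) i
  rwa [map_pow, e.apply_symm_apply, map_one, Pi.pow_apply, Pi.one_apply, ← ofAdd_nsmul, nsmul_one,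
    ofAdd_eq_one, ZMod.natCast_eq_zero_iff] at hi

theorem eq_of_not_dvd_of_forall_pow_mem {p : ℕ} {C : Subgroup (∀ i, Multiplicative (ZMod (n i)))}
    (hC : (Nat.card C).Prime) (hpow : ∀ x, x ^ p ∈ C) {i k : ι} (hi : ¬ n i ∣ p)
    (hk : ¬ n k ∣ p) : i = k := by
  classical
  have hdvd (l : ι) : n l ∣ p ↔ Multiplicative.ofAdd (1 : ZMod (n l)) ^ p = 1 := by
    rw [← ofAdd_nsmul, nsmul_one, ofAdd_eq_one, ZMod.natCast_eq_zero_iff]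
  by_contra hik
  let u (l : ι) : C := ⟨Pi.mulSingle l (Multiplicative.ofAdd 1) ^ p, hpow _⟩
  have hui : u i ≠ 1 := fun h => hi <| (hdvd i).2 <| by
    simpa [u] using congrFun (congrArg Subtype.val h) i
  have := Fact.mk hC
  obtain ⟨z, hz⟩ := Subgroup.mem_zpowers_iff.1 (mem_zpowers_of_prime_card rfl (g' := u k) hui)
  refine hk ((hdvd k).2 ?_)
  simpa [u, Ne.symm hik, eq_comm] using congrFun (congrArg Subtype.val hz) k

variable [Fintype ι]

theorem rank_pi_multiplicative_zmod [Group.FG (∀ i, Multiplicative (ZMod (n i)))] {p : ℕ}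
    (hp : p.Prime) (hn : ∀ i, p ∣ n i) :
    Group.rank (∀ i, Multiplicative (ZMod (n i))) = Fintype.card ι := by
  classical
  refine le_antisymm ?_ ?_
  · refine (Group.rank_le (S := Finset.univ.image fun i => Pi.mulSingle i (Multiplicative.ofAdd 1))
      ?_).trans Finset.card_image_le
    rw [Finset.coe_image, Finset.coe_univ, Set.image_univ, closure_range_mulSingle_ofAdd_one]
  · have := Fact.mk hp
    let π : (∀ i, Multiplicative (ZMod (n i))) →* (ι → Multiplicative (ZMod p)) :=
      MonoidHom.piMap fun i => (ZMod.castHom (hn i) (ZMod p)).toAddMonoidHom.toMultiplicative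
    have hπ : Function.Surjective π :=
      Function.Surjective.piMap fun i => ZMod.castHom_surjective (hn i)
    have hexp (x : ι → Multiplicative (ZMod p)) : x ^ p = 1 :=
      funext fun i => Multiplicative.toAdd.injective (by simp)
    have hdvd := card_dvd_exponent_pow_rank' _ hexp
    rw [Nat.card_fun, Nat.card_eq_fintype_card (α := ι), Nat.card_congr Multiplicative.toAdd,
      Nat.card_zmod, Nat.pow_dvd_pow_iff_le_right hp.one_lt] at hdvd
    exact hdvd.trans (Group.rank_le_of_surjective π hπ)

theorem nonempty_pi_mulEquiv {k q : ℕ} (hk : Fintype.card ι = k) (hn : ∀ i, n i = q) :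
    Nonempty ((∀ i, Multiplicative (ZMod (n i))) ≃* Multiplicative (Fin k → ZMod q)) := by
  obtain rfl : n = fun _ => q := funext hn
  exact ⟨(MulEquiv.arrowCongr (Fintype.equivFinOfCardEq hk) (MulEquiv.refl _)).trans
    (MulEquiv.funMultiplicative _ _).symm⟩

theorem nonempty_pi_mulEquiv_prod {k q r : ℕ} (hk : Fintype.card ι = k) (i₀ : ι) (hi₀ : n i₀ = r)
    (hn : ∀ i ≠ i₀, n i = q) :
    Nonempty ((∀ i, Multiplicative (ZMod (n i))) ≃*
      Multiplicative ((Fin (k - 1) → ZMod q) × ZMod r)) := by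
  classical
  obtain ⟨e⟩ := nonempty_pi_mulEquiv (ι := {i // i ≠ i₀}) (n := fun i => n i)
    (k := k - 1) (by simp [Fintype.card_subtype_compl, hk]) fun i => hn i i.2
  let split : (∀ i, Multiplicative (ZMod (n i))) ≃*
      Multiplicative (ZMod (n i₀)) × ∀ i : {i // i ≠ i₀}, Multiplicative (ZMod (n i)) :=
    { Equiv.piSplitAt i₀ _ with map_mul' := fun _ _ => rfl }
  subst hi₀
  exact ⟨split.trans <| MulEquiv.prodComm.trans <|
    (e.prodCongr (MulEquiv.refl _)).trans (MulEquiv.prodMultiplicative _ _).symm⟩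

theorem IsElementaryAbelian.nonempty_mulEquiv {p s : ℕ} (hp : p.Prime) {A : Type*} [Group A]
    (hA : IsElementaryAbelian p A) (hcard : Nat.card A = p ^ s) :
    Nonempty (A ≃* Multiplicative (Fin s → ZMod p)) := by
  have : Finite A := Nat.finite_of_card_ne_zero (hcard ▸ pow_ne_zero s hp.ne_zero)
  let _ : CommGroup A := { ‹Group A› with mul_comm := hA.1 }
  obtain ⟨ι, _, n, hn, ⟨e⟩⟩ := CommGroup.equiv_prod_multiplicative_zmod_of_finite A
  have hnp (i : ι) : n i = p :=
    ((Nat.dvd_prime hp).1 (dvd_of_mulEquiv_pi e hA.2 i)).resolve_left (hn i).ne'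
  obtain ⟨e'⟩ := nonempty_pi_mulEquiv rfl hnp
  obtain rfl : Fintype.card ι = s := Nat.pow_right_injective hp.two_le <| by
    change p ^ Fintype.card ι = p ^ s
    simp [← hcard, Nat.card_congr ((e.trans e').toEquiv.trans Multiplicative.toAdd), Nat.card_fun]
  exact ⟨e.trans e'⟩

/-- `A` is isomorphic to `ℤ_p ^ m` or to `ℤ_p ^ (m - 1) × ℤ_{p²}`. Only meaningful for `0 < m`, as
the subtraction is truncated. -/
def IsAlmostElementaryAbelian (p m : ℕ) (A : Type*) [Group A] : Prop :=
  Nonempty (A ≃* Multiplicative (Fin m → ZMod p)) ∨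
    Nonempty (A ≃* Multiplicative ((Fin (m - 1) → ZMod p) × ZMod (p ^ 2)))

theorem IsAlmostElementaryAbelian.pow_le_card {p m : ℕ} (hp : 0 < p) {A : Type*} [Group A]
    (hA : IsAlmostElementaryAbelian p m A) : p ^ m ≤ Nat.card A := by
  rcases hA with ⟨⟨e⟩⟩ | ⟨⟨e⟩⟩
  · simp [Nat.card_congr (e.toEquiv.trans Multiplicative.toAdd), Nat.card_fun]
  · rw [Nat.card_congr (e.toEquiv.trans Multiplicative.toAdd), Nat.card_prod, Nat.card_fun,
      Nat.card_zmod, Nat.card_zmod, Nat.card_fin, ← pow_add]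
    exact Nat.pow_le_pow_right hp (by lia)

/-- Two cyclic factors of order `p ^ 2` would contribute independent `p`-th powers. -/
theorem isAlmostElementaryAbelian_of_forall_pow_mem {p : ℕ} (hp : p.Prime) {A : Type*} [CommGroup A]
    [Finite A] {C : Subgroup A} (hC : Nat.card C = p) (hpow : ∀ x : A, x ^ p ∈ C) :
    IsAlmostElementaryAbelian p (Group.rank A) A := by
  obtain ⟨ι, _, n, hn, ⟨e⟩⟩ := CommGroup.equiv_prod_multiplicative_zmod_of_finite A
  have hexp (x : A) : x ^ p ^ 2 = 1 := by
    have h : (⟨x ^ p, hpow x⟩ : C) ^ p = 1 := by rw [← pow_card_eq_one' (G := C), hC]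
    rw [sq, pow_mul]
    exact congrArg Subtype.val h
  have hdvd (i : ι) : n i ∣ p ^ 2 := dvd_of_mulEquiv_pi e hexp i
  have hn' (i : ι) : n i = p ∨ n i = p ^ 2 := by
    obtain ⟨k, hk, hni⟩ := (Nat.dvd_prime_pow hp).1 (hdvd i)
    have := hn i
    interval_cases k <;> simp_all
  have := Finite.of_equiv A e.toEquiv
  have hrank : Fintype.card ι = Group.rank A := by
    rw [Group.rank_congr e, rank_pi_multiplicative_zmod hp]
    rintro i
    rcases hn' i with h | h <;> rw [h]
    exact dvd_pow_self p two_ne_zero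
  by_cases h : ∃ i₀, n i₀ = p ^ 2
  · obtain ⟨i₀, hi₀⟩ := h
    have hC' : (Nat.card (C.map e.toMonoidHom)).Prime := by
      rwa [Subgroup.card_map_of_injective e.injective, hC]
    have hpow' (y) : y ^ p ∈ C.map e.toMonoidHom :=
      ⟨e.symm y ^ p, hpow _, by simp⟩
    have hsq : ¬ p ^ 2 ∣ p := Nat.not_dvd_of_pos_of_lt hp.pos (by nlinarith [hp.two_le])
    obtain ⟨e'⟩ := nonempty_pi_mulEquiv_prod hrank i₀ hi₀ fun i hi => (hn' i).resolve_right
      fun h => hi (eq_of_not_dvd_of_forall_pow_mem hC' hpow' (h ▸ hsq) (hi₀ ▸ hsq))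
    exact Or.inr ⟨e.trans e'⟩
  · obtain ⟨e'⟩ := nonempty_pi_mulEquiv hrank fun i => (hn' i).resolve_right fun hi => h ⟨i, hi⟩
    exact Or.inl ⟨e.trans e'⟩

end AbelianGroups

/-- `E(p, j)` with `j ∈ {0, 1}`, when it is extra-special of order `p ^ 3`. -/
def IsExtraSpecialFactor (p j : ℕ) : Prop :=
  (j = 0 ∨ j = 1) ∧ IsExtraSpecial p (E p j) ∧ Nat.card (E p j) = p ^ 3

/-- `T` is an iterated central product of the groups in `L`, followed by `n` extra-special groups
`E(p, 0)` or `E(p, 1)` and an abelian group `A ∈ 𝒜_{m,p}` as in the second part of the lemma. -/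
def HasFactorization (p n m : ℕ) (T : Type*) [Group T] (L : List GrpCat.{0}) : Prop :=
  ∃ j : Fin n → ℕ, (∀ k, IsExtraSpecialFactor p (j k)) ∧
    ∃ (A : Type) (_ : CommGroup A), MemA m p A ∧ IsAlmostElementaryAbelian p m A ∧
      IsIteratedCentralProduct p T (L ++ factorList p j A)

theorem IsIteratedCentralProductFrom.congr {d : ℕ} {H H' : Type*} [Group H] [Group H']
    (e : H' ≃* H) (l : List GrpCat.{0}) (G₀ : GrpCat.{0})
    (h : IsIteratedCentralProductFrom d H G₀ l) : IsIteratedCentralProductFrom d H' G₀ l := by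
  induction l generalizing G₀ with
  | nil => exact h.map e.trans
  | cons G₁ l ih =>
    obtain ⟨φ, hmax, hcyclic, hcard, h⟩ := h
    exact ⟨φ, hmax, hcyclic, hcard, ih _ h⟩

theorem IsIteratedCentralProduct.congr {d : ℕ} {H H' : Type*} [Group H] [Group H']
    (e : H' ≃* H) {l : List GrpCat.{0}} (h : IsIteratedCentralProduct d H l) :
    IsIteratedCentralProduct d H' l := by
  cases l with
  | nil =>
    have : Subsingleton H := h
    exact e.injective.subsingleton
  | cons G₀ l => exact IsIteratedCentralProductFrom.congr e l G₀ h

theorem factorList_cons (d j₀ : ℕ) {n : ℕ} (j : Fin n → ℕ) (A : Type) [CommGroup A] :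
    factorList d (Fin.cons j₀ j : Fin (n + 1) → ℕ) A = GrpCat.of (E d j₀) :: factorList d j A := by
  rw [factorList, List.ofFn_succ]
  rfl

namespace HasFactorization

variable {p n m : ℕ} {T : Type*} [Group T] {L L' : List GrpCat.{0}}

theorem congr {T' : Type*} [Group T'] (e : T' ≃* T) (h : HasFactorization p n m T L) :
    HasFactorization p n m T' L := by
  obtain ⟨j, hj, A, _, hA, hA', h⟩ := h
  exact ⟨j, hj, A, _, hA, hA', h.congr e⟩

theorem succ {j₀ : ℕ} (h : HasFactorization p n m T L) (hj₀ : IsExtraSpecialFactor p j₀)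
    (hL : ∀ l, IsIteratedCentralProduct p T (L ++ l) →
      IsIteratedCentralProduct p T (L' ++ GrpCat.of (E p j₀) :: l)) :
    HasFactorization p (n + 1) m T L' := by
  obtain ⟨j, hj, A, _, hA, hA', h⟩ := h
  refine ⟨Fin.cons j₀ j, Fin.cases hj₀ hj, A, _, hA, hA', ?_⟩
  rw [factorList_cons]
  exact hL _ h

theorem prepend {j₀ : ℕ} (h : HasFactorization p n m T [GrpCat.of (E p j₀)])
    (hj₀ : IsExtraSpecialFactor p j₀) : HasFactorization p (n + 1) m T [] :=
  h.succ hj₀ fun _ h => h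

theorem insert {j₀ : ℕ} {G₀ : Type} [Group G₀] {φ : CentralIso G₀ (E p j₀)} (hφ : φ.IsMaximal)
    (hcyclic : IsCyclic φ.source) (hcard : Nat.card φ.source = p)
    (h : HasFactorization p n m T [GrpCat.of φ.CentralProduct]) (hj₀ : IsExtraSpecialFactor p j₀) :
    HasFactorization p (n + 1) m T [GrpCat.of G₀] :=
  h.succ hj₀ fun _ h => ⟨φ, hφ, hcyclic, hcard, h⟩

end HasFactorization

section Splitting

variable {p : ℕ} {T : Type*} [Group T] (hT : IsGeneralizedExtraspecial p T)

include hT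

theorem IsGeneralizedExtraspecial.commutator_le_centralizer (s : Set T) :
    commutator T ≤ centralizer s :=
  hT.commutator_le_center.trans (Subgroup.center_le_centralizer s)

variable [hp : Fact p.Prime]

theorem IsGeneralizedExtraspecial.exists_injective_hom {x y : T} (hxy : ¬ Commute x y) :
    ∃ (a b : T) (j : ℕ) (f : E p j →* T), a ∈ closure {x, y} ∧ b ∈ closure {x, y} ∧
      ¬ Commute a b ∧ IsExtraSpecialFactor p j ∧ Function.Injective f ∧
        f.range = closure {a, b} := by
  obtain ⟨a, ha, b, hb, hab, j, hj, h⟩ := hT.hasHeisenbergPair hxy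
  have hE := h.isGeneralizedExtraspecial hab
  exact ⟨a, b, j, E.lift h, ha, hb, hab, ⟨hj, hE.isExtraSpecial (E.closure_α_β p j),
    hE.card_eq_pow_three (E.closure_α_β p j)⟩, h.lift_injective hab, E.range_lift h⟩

theorem IsGeneralizedExtraspecial.card_centralizer_eq_mul {H : Subgroup T} {a b : T}
    (hab : ¬ Commute a b) (hH : closure {a, b} ≤ centralizer H) :
    Nat.card (centralizer (H : Set T)) =
      p ^ 2 * Nat.card (centralizer ((H ⊔ closure {a, b} : Subgroup T) : Set T)) := by
  set K := closure {a, b}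
  have : (centralizer (K : Set T)).Normal :=
    Subgroup.Normal.of_commutator_le _ (hT.commutator_le_centralizer _)
  have htop : centralizer (H : Set T) ⊔ centralizer K = ⊤ :=
    top_le_iff.1 ((hT.isNondegenerateFactor_closure_pair hab).sup_centralizer.ge.trans
      (sup_le_sup_right hH _))
  have hindex : (centralizer (K : Set T)).relIndex (centralizer H) = p ^ 2 := by
    rw [← Subgroup.relIndex_sup_right, htop, Subgroup.relIndex_top_right,
      hT.index_centralizer_closure_pair hab]
  have := Subgroup.relIndex_inf_mul_relIndex ⊥ (centralizer (K : Set T)) (centralizer H)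
  rw [bot_inf_eq, Subgroup.relIndex_bot_left, Subgroup.relIndex_bot_left, hindex] at this
  rw [centralizer_sup, inf_comm, ← this, mul_comm]

end Splitting

section Gluing

theorem map_center_le_centralizer_range {G H : Type*} [Group G] [Group H] (f : G →* H) :
    (center G).map f ≤ centralizer f.range := by
  rw [← Subgroup.centralizer_univ, MonoidHom.range_eq_map]
  exact Subgroup.map_centralizer_le_centralizer_image _ _

variable {T : Type*} [Group T] {G₀ G₁ : Type*} [Group G₀] [Group G₁] {f₀ : G₀ →* T} {f₁ : G₁ →* T}
  (h₀ : Function.Injective f₀) (h₁ : Function.Injective f₁)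
  (hf₀ : IsNondegenerateFactor f₀.range)
  (hf₁ : commutator T ≤ f₁.range) (hcomm : ∀ x y, Commute (f₀ x) (f₁ y))

include hf₀ hf₁ in
theorem IsNondegenerateFactor.isMaximal_ofCommute :
    (CentralIso.ofCommute h₀ h₁ hcomm).IsMaximal :=
  CentralIso.isMaximal_ofCommute h₀ h₁ hcomm <|
    (le_inf (Subgroup.map_le_range _ _) (map_center_le_centralizer_range f₀)).trans
      (hf₀.inf_centralizer_le.trans hf₁)

include hf₀ hf₁ in
theorem IsNondegenerateFactor.card_source_ofCommute {p : ℕ}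
    (hT : IsGeneralizedExtraspecial p T) :
    Nat.card (CentralIso.ofCommute h₀ h₁ hcomm).source = p := by
  have hle : f₁.range ≤ centralizer f₀.range := by
    rintro _ ⟨y, rfl⟩ _ ⟨x, rfl⟩
    exact hcomm x y
  have hinf : f₀.range ⊓ f₁.range = commutator T :=
    le_antisymm ((inf_le_inf_left _ hle).trans hf₀.inf_centralizer_le)
      (le_inf hf₀.commutator_le hf₁)
  rw [← hT.card_commutator, ← hinf]
  exact Nat.card_congr (CentralIso.comapRangeEquiv f₁ h₀).toEquiv

end Gluing

theorem IsGeneralizedExtraspecial.exists_not_commute {p : ℕ} [Fact p.Prime] {T : Type*} [Group T]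
    (hT : IsGeneralizedExtraspecial p T) : ∃ x y : T, ¬ Commute x y := by
  by_contra! h
  have hcenter : center T = ⊤ := (Subgroup.eq_top_iff' _).2 fun x =>
    Subgroup.mem_center_iff.2 fun y => h y x
  refine hT.commutator_ne_bot ?_
  rw [commutator_def, Subgroup.commutator_eq_bot_iff_le_centralizer, Subgroup.coe_top,
    Subgroup.centralizer_univ, hcenter]

theorem isIteratedCentralProduct_pair {d : ℕ} {T : Type*} [Group T] {G₀ G₁ : Type} [Group G₀]
    [Group G₁] {f₀ : G₀ →* T} {f₁ : G₁ →* T} (h₀ : Function.Injective f₀)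
    (h₁ : Function.Injective f₁) (hcomm : ∀ x y, Commute (f₀ x) (f₁ y))
    (hmax : (CentralIso.ofCommute h₀ h₁ hcomm).IsMaximal)
    (hcyclic : IsCyclic (CentralIso.ofCommute h₀ h₁ hcomm).source)
    (hcard : Nat.card (CentralIso.ofCommute h₀ h₁ hcomm).source = d)
    (hsup : f₀.range ⊔ f₁.range = ⊤) :
    IsIteratedCentralProduct d T [GrpCat.of G₀, GrpCat.of G₁] :=
  ⟨_, hmax, hcyclic, hcard, ⟨(MulEquiv.ofBijective (CentralIso.ofCommuteHom h₀ h₁ hcomm)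
    ⟨CentralIso.ofCommuteHom_injective h₀ h₁ hcomm, by
      rw [← MonoidHom.range_eq_top, CentralIso.range_ofCommuteHom, hsup]⟩).symm⟩⟩

section Recursion

variable {p : ℕ} [hp : Fact p.Prime]

theorem memA_rank {A : Type*} [CommGroup A] [Finite A] (hdvd : p ∣ Nat.card A) :
    MemA (Group.rank A) p A :=
  ⟨inferInstance, rfl, exists_prime_orderOf_dvd_card' p hdvd⟩

theorem IsNondegenerateFactor.exists_centralIso {T : Type*} [Group T]
    (hT : IsGeneralizedExtraspecial p T) {G₀ : Type*} [Group G₀] {f₀ : G₀ →* T}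
    (h₀ : Function.Injective f₀) (hf₀ : IsNondegenerateFactor f₀.range) {x y : T}
    (hx : x ∈ centralizer (f₀.range : Set T)) (hy : y ∈ centralizer (f₀.range : Set T))
    (hxy : ¬ Commute x y) :
    ∃ j, IsExtraSpecialFactor p j ∧ ∃ φ : CentralIso G₀ (E p j), φ.IsMaximal ∧
      IsCyclic φ.source ∧ Nat.card φ.source = p ∧ ∃ f : φ.CentralProduct →* T,
        Function.Injective f ∧ IsNondegenerateFactor f.range ∧
          Nat.card (centralizer (f₀.range : Set T)) =
            p ^ 2 * Nat.card (centralizer (f.range : Set T)) := by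
  obtain ⟨a, b, j, f₁, ha, hb, hab, hj, h₁, hrange⟩ := hT.exists_injective_hom hxy
  have hle : closure {x, y} ≤ centralizer f₀.range :=
    (Subgroup.closure_le _).2 (Set.pair_subset hx hy)
  have hK : closure {a, b} ≤ centralizer f₀.range :=
    (Subgroup.closure_le _).2 (Set.pair_subset (hle ha) (hle hb))
  have hf₁ := hT.isNondegenerateFactor_closure_pair hab
  have hcomm (x : G₀) (y : E p j) : Commute (f₀ x) (f₁ y) := hK (hrange ▸ ⟨y, rfl⟩) _ ⟨x, rfl⟩
  have hf₁' : commutator T ≤ f₁.range := hrange ▸ hf₁.commutator_le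
  have hcard := hf₀.card_source_ofCommute h₀ h₁ hf₁' hcomm hT
  refine ⟨j, hj, _, hf₀.isMaximal_ofCommute h₀ h₁ hf₁' hcomm, isCyclic_of_prime_card hcard, hcard,
    _, CentralIso.ofCommuteHom_injective h₀ h₁ hcomm, ?_⟩
  rw [CentralIso.range_ofCommuteHom, hrange]
  exact ⟨hf₀.sup hf₁ hK, hT.card_centralizer_eq_mul hab hK⟩

variable {T : Type} [Group T] [Finite T] (hT : IsGeneralizedExtraspecial p T)

include hT

theorem IsNondegenerateFactor.exists_hasFactorization_zero {G₀ : Type} [Group G₀] {f₀ : G₀ →* T}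
    (h₀ : Function.Injective f₀) (hf₀ : IsNondegenerateFactor f₀.range)
    (hcomm : ∀ x ∈ centralizer (f₀.range : Set T), ∀ y ∈ centralizer (f₀.range : Set T),
      Commute x y) :
    ∃ m, 0 < m ∧ p ^ m ≤ Nat.card (centralizer (f₀.range : Set T)) ∧
      HasFactorization p 0 m T [GrpCat.of G₀] := by
  set A := centralizer (f₀.range : Set T)
  let _ : CommGroup A := { mul_comm := fun x y => Subtype.ext (hcomm x x.2 y y.2) }
  have hle : commutator T ≤ A := hT.commutator_le_centralizer _
  have hC : Nat.card ((commutator T).subgroupOf A) = p := by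
    rw [Nat.card_congr (Subgroup.subgroupOfEquivOfLe hle).toEquiv, hT.card_commutator]
  have hdvd : p ∣ Nat.card A := hC ▸ Subgroup.card_subgroup_dvd_card _
  have hA : IsAlmostElementaryAbelian p (Group.rank A) A :=
    isAlmostElementaryAbelian_of_forall_pow_mem hp.out hC fun x => hT.pow_mem_commutator x
  have : Nontrivial A := Finite.one_lt_card_iff_nontrivial.1 <|
    hp.out.one_lt.trans_le (Nat.le_of_dvd Nat.card_pos hdvd)
  have hf₁ : commutator T ≤ A.subtype.range := by rwa [Subgroup.range_subtype]
  have hc (x : G₀) (y : A) : Commute (f₀ x) (A.subtype y) := y.2 _ ⟨x, rfl⟩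
  have hcard := hf₀.card_source_ofCommute h₀ A.subtype_injective hf₁ hc hT
  refine ⟨Group.rank A, Group.rank_pos A, hA.pow_le_card hp.out.pos, Fin.elim0, (·.elim0), A, _,
    memA_rank hdvd, hA, ?_⟩
  exact isIteratedCentralProduct_pair h₀ A.subtype_injective hc
    (hf₀.isMaximal_ofCommute h₀ A.subtype_injective hf₁ hc) (isCyclic_of_prime_card hcard) hcard
    (by rw [Subgroup.range_subtype, hf₀.sup_centralizer])

theorem IsNondegenerateFactor.exists_hasFactorization {G₀ : Type} [Group G₀] {f₀ : G₀ →* T}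
    (h₀ : Function.Injective f₀) (hf₀ : IsNondegenerateFactor f₀.range) :
    ∃ n m, 0 < m ∧ p ^ (2 * n + m) ≤ Nat.card (centralizer (f₀.range : Set T)) ∧
      HasFactorization p n m T [GrpCat.of G₀] := by
  induction hN : Nat.card (centralizer (f₀.range : Set T)) using Nat.strong_induction_on
    generalizing G₀ with | _ N ih
  by_cases hcomm : ∀ x ∈ centralizer (f₀.range : Set T), ∀ y ∈ centralizer (f₀.range : Set T),
      Commute x y
  · obtain ⟨m, hm, hle, h⟩ := hf₀.exists_hasFactorization_zero hT h₀ hcomm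
    exact ⟨0, m, hm, by rwa [mul_zero, zero_add, ← hN], h⟩
  push Not at hcomm
  obtain ⟨x, hx, y, hy, hxy⟩ := hcomm
  obtain ⟨j, hj, φ, hφ, hcyclic, hcard, f, h₁, hf, hmul⟩ := hf₀.exists_centralIso hT h₀ hx hy hxy
  rw [hN] at hmul
  have hlt : Nat.card (centralizer (f.range : Set T)) < N :=
    hmul ▸ lt_mul_of_one_lt_left Nat.card_pos (Nat.one_lt_pow two_ne_zero hp.out.one_lt)
  obtain ⟨n, m, hm, hle, h⟩ := ih _ hlt h₁ hf rfl
  refine ⟨n + 1, m, hm, ?_, h.insert hφ hcyclic hcard hj⟩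
  calc p ^ (2 * (n + 1) + m) = p ^ 2 * p ^ (2 * n + m) := by ring
    _ ≤ N := hmul ▸ Nat.mul_le_mul_left _ hle

theorem IsGeneralizedExtraspecial.exists_hasFactorization :
    ∃ n m, 0 < n ∧ 0 < m ∧ p ^ (2 * n + m) ≤ Nat.card T ∧ HasFactorization p n m T [] := by
  obtain ⟨x, y, hxy⟩ := hT.exists_not_commute
  obtain ⟨a, b, j, f, -, -, hab, hj, hf, hrange⟩ := hT.exists_injective_hom hxy
  obtain ⟨n, m, hm, hle, h⟩ := IsNondegenerateFactor.exists_hasFactorization hT hf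
    (hrange ▸ hT.isNondegenerateFactor_closure_pair hab)
  refine ⟨n + 1, m, n.succ_pos, hm, ?_, h.prepend hj⟩
  rw [hrange] at hle
  calc p ^ (2 * (n + 1) + m) = p ^ (2 * n + m) * p ^ 2 := by ring
    _ ≤ Nat.card (centralizer (closure {a, b} : Set T)) * p ^ 2 := Nat.mul_le_mul_right _ hle
    _ = Nat.card T := by rw [← hT.index_centralizer_closure_pair hab, Subgroup.card_mul_index]

end Recursion

section Quotients

variable {p : ℕ}

theorem IsElementaryAbelian.exists_iInf_eq_bot {s : ℕ} (hp : p.Prime) {A : Type*} [Group A]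
    (hA : IsElementaryAbelian p A) (hcard : Nat.card A = p ^ s) :
    ∃ H : Fin s → Subgroup A, (∀ i, (H i).index = p) ∧ ⨅ i, H i = ⊥ := by
  obtain ⟨e⟩ := hA.nonempty_mulEquiv hp hcard
  let π (i : Fin s) : A →* Multiplicative (ZMod p) :=
    (AddMonoidHom.toMultiplicative (Pi.evalAddMonoidHom _ i)).comp e.toMonoidHom
  refine ⟨fun i => (π i).ker, fun i => ?_, ?_⟩
  · have hsurj : Function.Surjective (π i) :=
      (Function.surjective_eval (β := fun _ => ZMod p) i).comp e.surjective
    rw [Subgroup.index_ker, MonoidHom.range_eq_top.2 hsurj, Subgroup.card_top]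
    exact Nat.card_zmod p
  · refine (Subgroup.eq_bot_iff_forall _).2 fun x hx => e.injective ?_
    rw [map_one]
    exact funext fun i => Subgroup.mem_iInf.1 hx i

variable {S : Type*} [Group S]

theorem IsSpecial.isElementaryAbelian (hS : IsSpecial p S) (hcomm : ∀ x y : S, x * y = y * x) :
    IsElementaryAbelian p S := by
  rcases hS.2.2 with h | ⟨h, -, he⟩
  · exact h
  · exact ⟨hcomm, fun x => congrArg Subtype.val
      (he.2 ⟨x, h ▸ Subgroup.mem_center_iff.2 fun y => hcomm y x⟩)⟩

theorem IsSpecial.center_eq_commutator (hS : IsSpecial p S) (hne : ¬ ∀ x y : S, x * y = y * x) :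
    center S = commutator S :=
  hS.2.2.elim (fun h => absurd h.1 hne) fun h => h.2.1

theorem IsSpecial.isElementaryAbelian_center (hS : IsSpecial p S)
    (hne : ¬ ∀ x y : S, x * y = y * x) : IsElementaryAbelian p (center S) := by
  rcases hS.2.2 with h | ⟨h, -, he⟩
  · exact absurd h.1 hne
  · rwa [h] at he

theorem pow_mem_center {n : ℕ} (hS : commutator S ≤ center S) (hn : ∀ z ∈ center S, z ^ n = 1)
    (x : S) : x ^ n ∈ center S := by
  refine Subgroup.mem_center_iff.2 fun y => (groupComm_eq_one_iff.1 ?_).symm.eq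
  have h := hS (groupComm_mem_commutator x y)
  rw [groupComm_pow_left h, hn _ h]

theorem isGeneralizedExtraspecial_of_surjective {T : Type*} [Group T] {f : S →* T}
    (hf : Function.Surjective f) (hS : center S = commutator S)
    (hpow : ∀ z ∈ center S, z ^ p = 1) (hker : f.ker.relIndex (center S) = p) :
    IsGeneralizedExtraspecial p T := by
  have hmap : commutator T = (center S).map f := by
    rw [hS, commutator_def, commutator_def, Subgroup.map_commutator,
      Subgroup.map_top_of_surjective _ hf]
  refine ⟨?_, ?_, ?_⟩
  · rw [hmap, Subgroup.map_le_iff_le_comap]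
    refine fun z hz => Subgroup.mem_center_iff.2 fun y => ?_
    obtain ⟨y, rfl⟩ := hf y
    rw [← map_mul, Subgroup.mem_center_iff.1 hz, map_mul]
  · rw [hmap, ← Subgroup.relIndex_ker, hker]
  · intro x
    obtain ⟨x, rfl⟩ := hf x
    rw [hmap, ← map_pow]
    exact Subgroup.mem_map_of_mem _ (pow_mem_center hS.ge hpow x)

theorem exists_hasFactorization_quotient [hp : Fact p.Prime] [Finite S]
    (hS : center S = commutator S) (hpow : ∀ z ∈ center S, z ^ p = 1) {K : Subgroup S} [K.Normal]
    (hK : K.relIndex (center S) = p) :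
    ∃ n m, 0 < n ∧ 0 < m ∧ p ^ (2 * n + m) ≤ Nat.card (S ⧸ K) ∧
      HasFactorization p n m (S ⧸ K) [] := by
  let e : S ⧸ K ≃* Shrink.{0} (S ⧸ K) := Shrink.mulEquiv.symm
  have hker : ((e : S ⧸ K →* Shrink.{0} (S ⧸ K)).comp (QuotientGroup.mk' K)).ker = K := by
    rw [MonoidHom.ker_mulEquiv_comp, QuotientGroup.ker_mk']
  have hT := isGeneralizedExtraspecial_of_surjective
    (e.surjective.comp (QuotientGroup.mk'_surjective K)) hS hpow (hker.symm ▸ hK)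
  obtain ⟨n, m, hn, hm, hle, h⟩ := hT.exists_hasFactorization
  exact ⟨n, m, hn, hm, Nat.card_congr e.toEquiv ▸ hle, h.congr e⟩

theorem exists_le_center_iInf_eq_bot (hp : p.Prime) (hS : IsElementaryAbelian p (center S))
    {s : ℕ} (hs : Nat.card (center S) = p ^ s) (hs₀ : 0 < s) :
    ∃ K : Fin s → Subgroup S, (∀ i, K i ≤ center S) ∧ ⨅ i, K i = ⊥ ∧
      ∀ i, (K i).relIndex (center S) = p := by
  obtain ⟨H, hindex, hH⟩ := hS.exists_iInf_eq_bot hp hs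
  have : Nonempty (Fin s) := Fin.pos_iff_nonempty.1 hs₀
  have hinj := (center S).subtype_injective
  refine ⟨fun i => (H i).map (center S).subtype, fun i => Subgroup.map_subtype_le _, ?_,
    fun i => ?_⟩
  · rw [← Subgroup.map_iInf _ hinj, hH, Subgroup.map_bot]
  · rw [Subgroup.relIndex, Subgroup.subgroupOf, Subgroup.comap_map_eq_self_of_injective hinj,
      hindex]

theorem IsSpecial.pos_of_card_center (hS : IsSpecial p S) (hne : ¬ ∀ x y : S, x * y = y * x)
    {s : ℕ} (hs : Nat.card (center S) = p ^ s) : 0 < s := by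
  refine Nat.pos_of_ne_zero fun hs₀ => hne fun x y => groupComm_eq_one_iff.1 ?_
  have hcenter : center S = ⊥ := Subgroup.card_eq_one.1 (by rw [hs, hs₀, pow_zero])
  rw [← Subgroup.mem_bot, ← hcenter, hS.center_eq_commutator hne]
  exact groupComm_mem_commutator x y

theorem IsSpecial.exists_hasFactorization [hp : Fact p.Prime] (hS : IsSpecial p S)
    (hne : ¬ ∀ x y : S, x * y = y * x) {r s : ℕ} (hr : Nat.card S = p ^ r)
    (hs : Nat.card (center S) = p ^ s) :
    ∃ (K : Fin s → Subgroup S) (_ : ∀ i, (K i).Normal), (∀ i, K i ≤ center S) ∧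
      (⨅ i, K i) = ⊥ ∧ ∀ i, ∃ n m, 0 < n ∧ 0 < m ∧ 2 * n + m ≤ r ∧
        HasFactorization p n m (S ⧸ K i) [] := by
  have := hS.1
  have hcenter := hS.isElementaryAbelian_center hne
  have hpow (z) (hz : z ∈ center S) : z ^ p = 1 := congrArg Subtype.val (hcenter.2 ⟨z, hz⟩)
  obtain ⟨K, hle, hK, hindex⟩ :=
    exists_le_center_iInf_eq_bot hp.out hcenter hs (hS.pos_of_card_center hne hs)
  have hnormal (i) : (K i).Normal := ⟨fun x hx g => by
    rwa [Subgroup.mem_center_iff.1 (hle i hx), mul_inv_cancel_right]⟩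
  refine ⟨K, hnormal, hle, hK, fun i => ?_⟩
  obtain ⟨n, m, hn, hm, hcard, h⟩ :=
    exists_hasFactorization_quotient (hS.center_eq_commutator hne) hpow (hindex i)
  have hcard' : p ^ (2 * n + m) ≤ p ^ r :=
    hcard.trans (hr ▸ Nat.card_le_card_of_surjective _ (QuotientGroup.mk'_surjective (K i)))
  exact ⟨n, m, hn, hm, (Nat.pow_le_pow_iff_right hp.out.one_lt).1 hcard', h⟩

end Quotients

section Embeddings

variable {p : ℕ}

theorem MemS.congr {n m : ℕ} {G G' : Type*} [Group G] [Group G'] (e : G' ≃* G) (h : MemS n m G) :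
    MemS n m G' := by
  obtain ⟨hfin, d, hd, j, hj, A, _, hA, h⟩ := h
  exact ⟨Finite.of_equiv _ e.symm.toEquiv, d, hd, j, hj, A, _, hA, h.congr e⟩

theorem MemSProd.mono {I J : Set (ℕ × ℕ)} (hIJ : I ⊆ J) {r : ℕ} {S : Type*} [Group S]
    (h : MemSProd I r S) : MemSProd J r S := by
  obtain ⟨G, hG, hf⟩ := h
  refine ⟨G, fun i => ?_, hf⟩
  obtain ⟨nm, hnm, h⟩ := hG i
  exact ⟨nm, hIJ hnm, h⟩

theorem HasFactorization.memS {n m : ℕ} (hp : p.Prime) {T : Type*} [Group T] [Finite T]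
    (h : HasFactorization p n m T []) : MemS n m T := by
  obtain ⟨j, hj, A, _, hA, -, h⟩ := h
  refine ⟨inferInstance, p, hp.pos, j, fun k => ?_, A, _, hA, h⟩
  have := hp.one_lt
  rcases (hj k).1 with h | h <;> lia

theorem MemSProd.of_iInf_ker_eq_bot {I : Set (ℕ × ℕ)} {r : ℕ} {S : Type*} [Group S]
    {G : Fin r → GrpCat.{0}} (hG : ∀ i, ∃ nm ∈ I, MemS nm.1 nm.2 (G i)) (f : ∀ i, S →* G i)
    (hf : ⨅ i, (f i).ker = ⊥) : MemSProd I r S := by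
  refine ⟨G, hG, MonoidHom.pi f, (injective_iff_map_eq_one _).2 fun x hx => ?_⟩
  rw [← Subgroup.mem_bot, ← hf, Subgroup.mem_iInf]
  exact congrFun hx

theorem MemSProd.of_iInf_eq_bot {I : Set (ℕ × ℕ)} {r s : ℕ} (hs : 0 < s) (hsr : s ≤ r)
    {S : Type*} [Group S] [Finite S] {K : Fin s → Subgroup S} [∀ i, (K i).Normal]
    (hK : ⨅ i, K i = ⊥) (hI : ∀ i, ∃ nm ∈ I, MemS nm.1 nm.2 (S ⧸ K i)) : MemSProd I r S := by
  have := Fin.pos_iff_nonempty.1 hs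
  let t : Fin r → Fin s := Function.invFun (Fin.castLE hsr)
  have ht : Function.Surjective t := Function.invFun_surjective (Fin.castLE_injective hsr)
  let e (i : Fin s) : S ⧸ K i ≃* Shrink.{0} (S ⧸ K i) := Shrink.mulEquiv.symm
  let q (i : Fin s) : S →* Shrink.{0} (S ⧸ K i) := (e i : _ →* _).comp (QuotientGroup.mk' (K i))
  have hq (i : Fin s) : (q i).ker = K i := by
    rw [MonoidHom.ker_mulEquiv_comp, QuotientGroup.ker_mk']
  refine MemSProd.of_iInf_ker_eq_bot (G := fun i => GrpCat.of (Shrink.{0} (S ⧸ K (t i))))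
    (fun i => ?_) (fun i => q (t i)) ?_
  · obtain ⟨nm, hnm, h⟩ := hI (t i)
    exact ⟨nm, hnm, h.congr (e (t i)).symm⟩
  · calc ⨅ i, (q (t i)).ker = ⨅ i, K i := by simp only [hq, ht.iInf_comp]
      _ = ⊥ := hK

instance E.subsingleton_one_zero : Subsingleton (E 1 0) := by
  have hα : E.α 1 0 = 1 := by simpa using (E.isHeisenbergPair_α_β 1 0).left_pow
  have hβ : E.β 1 0 = 1 := by simpa using (E.isHeisenbergPair_α_β 1 0).right_pow
  rw [← Subgroup.subsingleton_iff, ← subsingleton_iff_bot_eq_top, ← E.closure_α_β, hα, hβ,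
    Set.pair_eq_singleton, Subgroup.closure_singleton_one]

-- For `d = 1` the group `E(1, 0)` is trivial and every `A ∈ 𝒜_{m,1}` is `E(1, 0) ⋏ A`.
theorem memS_one_rank (A : Type) [CommGroup A] [Finite A] : MemS 1 (Group.rank A) A := by
  refine ⟨inferInstance, 1, one_pos, fun _ => 0, fun _ => one_pos, A, _,
    ⟨inferInstance, rfl, 1, orderOf_one⟩, ?_⟩
  have h₀ : Function.Injective (1 : E 1 0 →* A) := Function.injective_of_subsingleton _
  have h₁ : Function.Injective (MonoidHom.id A) := Function.injective_id
  have hcomm (x : E 1 0) (y : A) : Commute ((1 : E 1 0 →* A) x) (MonoidHom.id A y) := .one_left y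
  have htop : (MonoidHom.id A).range = ⊤ := MonoidHom.range_eq_top.2 Function.surjective_id
  have : Subsingleton (CentralIso.ofCommute h₀ h₁ hcomm).source :=
    Subtype.coe_injective.subsingleton
  exact isIteratedCentralProduct_pair h₀ h₁ hcomm
    (CentralIso.isMaximal_ofCommute h₀ h₁ hcomm (htop ▸ le_top)) inferInstance
    Nat.card_unique (by rw [htop, sup_top_eq])

theorem memSProd_of_isElementaryAbelian {r : ℕ} [hp : Fact p.Prime] {S : Type*} [Group S]
    (hS : IsElementaryAbelian p S) (hcard : Nat.card S = p ^ r) : MemSProd {(1, 1)} r S := by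
  obtain ⟨e⟩ := hS.nonempty_mulEquiv hp.out hcard
  have hrank : Group.rank (Multiplicative (ZMod p)) = 1 := by
    rw [← Group.rank_congr (MulEquiv.funUnique Unit _),
      rank_pi_multiplicative_zmod (n := fun _ : Unit => p) hp.out fun _ => dvd_rfl,
      Fintype.card_unit]
  exact ⟨fun _ => GrpCat.of (Multiplicative (ZMod p)),
    fun _ => ⟨_, rfl, hrank ▸ memS_one_rank (Multiplicative (ZMod p))⟩,
    (e.trans (MulEquiv.funMultiplicative _ _)).toMonoidHom, MulEquiv.injective _⟩

theorem IsSpecial.memSProd [hp : Fact p.Prime] {S : Type*} [Group S] (hS : IsSpecial p S)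
    (hne : ¬ ∀ x y : S, x * y = y * x) {r : ℕ} (hcard : Nat.card S = p ^ r) :
    MemSProd {nm | 0 < nm.1 ∧ 0 < nm.2 ∧ 2 * nm.1 + nm.2 ≤ r} r S := by
  have := hS.1
  obtain ⟨s, hs⟩ := (hS.2.1.to_subgroup (center S)).exists_card_eq
  have hsr : s ≤ r := by
    rw [← Nat.pow_le_pow_iff_right hp.out.one_lt, ← hs, ← hcard]
    exact Subgroup.card_le_card_group _
  obtain ⟨K, _, -, hK, h⟩ := hS.exists_hasFactorization hne hcard hs
  refine MemSProd.of_iInf_eq_bot (hS.pos_of_card_center hne hs) hsr hK fun i => ?_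
  obtain ⟨n, m, hn, hm, hle, h⟩ := h i
  exact ⟨(n, m), ⟨hn, hm, hle⟩, h.memS hp.out⟩

end Embeddings

end SpecialGroups

theorem lemma2p9 (p r : ℕ) (hp : p.Prime) (hr : 0 < r) (S : Type*) [Group S]
    (hS : SpecialGroups.IsSpecial p S) (hcard : Nat.card S = p ^ r) :
    SpecialGroups.MemSProd
      {nm : ℕ × ℕ | 0 < nm.1 ∧ 0 < nm.2 ∧ 2 * nm.1 + nm.2 ≤ max r 3} r S ∧
    ((¬ ∀ x y : S, x * y = y * x) →
      ∀ s : ℕ, Nat.card (Subgroup.center S) = p ^ s →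
        ∃ (K : Fin s → Subgroup S) (_ : ∀ i, (K i).Normal),
          (∀ i, K i ≤ Subgroup.center S) ∧ (⨅ i, K i) = ⊥ ∧
          ∀ i, ∃ n m : ℕ, 0 < n ∧ 0 < m ∧ 2 * n + m ≤ r ∧
            ∃ j : Fin n → ℕ,
              (∀ k, (j k = 0 ∨ j k = 1) ∧
                SpecialGroups.IsExtraSpecial p (SpecialGroups.E p (j k)) ∧
                Nat.card (SpecialGroups.E p (j k)) = p ^ 3) ∧
              ∃ (A : Type) (_ : CommGroup A), SpecialGroups.MemA m p A ∧
                (Nonempty (A ≃* Multiplicative (Fin m → ZMod p)) ∨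
                  Nonempty (A ≃* Multiplicative ((Fin (m - 1) → ZMod p) × ZMod (p ^ 2)))) ∧
                SpecialGroups.IsIteratedCentralProduct p (S ⧸ K i)
                  (SpecialGroups.factorList p j A)) := by
  have := Fact.mk hp
  refine ⟨?_, fun hne s hs => hS.exists_hasFactorization hne hcard hs⟩
  by_cases hcomm : ∀ x y : S, x * y = y * x
  · have helem : SpecialGroups.IsElementaryAbelian p S := hS.isElementaryAbelian hcomm
    refine (SpecialGroups.memSProd_of_isElementaryAbelian helem hcard).mono ?_
    rintro _ rfl
    exact ⟨one_pos, one_pos, le_max_right r 3⟩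
  · refine (hS.memSProd hcomm hcard).mono ?_
    rintro nm ⟨hn, hm, hle⟩
    exact ⟨hn, hm, hle.trans (le_max_left r 3)⟩
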